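/- Let $X\subset\mathbb{R}^n$ be a bounded domain with Lipschitz boundary, whose boundary consists of $s$ smooth surfaces $\partial X_1,\dots,\partial X_s$ that are disjoint up to sets of zero surface measure, and let $Y\subseteq\mathbb{R}^m$, $Z\subseteq\mathbb{R}^{m\times n}$ be nonempty. Write $\Omega:=\overline X\times\overline Y\times\overline Z$ and $\Gamma_i:=\partial X_i\times\overline Y$, and let $|X|$ and $|\partial X_i|$ denote volume and surface area. Let $l,f,g\in\mathbb{R}[x,y,z]$ and $h_1,\dots,h_s\in\mathbb{R}[x,y]$ be polynomials, and assume that the outward unit normal $\hat n$ to $X$ is given on each $\partial X_i$ by a vector of polynomials in $x$ (a possibly different one for each $i$). Suppose that $$\Omega=\{p_1\ge 0,\dots,p_r\ge 0\},\qquad \Gamma_i=\{q_{i,1}\ge 0,\dots,q_{i,t_i}\ge 0\}\quad(i=1,\dots,s)$$ for polynomials $p_j\in\mathbb{R}[x,y,z]$ and $q_{i,j}\in\mathbb{R}[x,y]$, and set $$Q(\Omega):=\Big\{\sigma_0+\sum_{j=1}^r\sigma_jp_j\Big\},\qquad Q(\Gamma_i):=\Big\{\sigma_0+\sum_{j=1}^{t_i}\sigma_jq_{i,j}\Big\},$$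 where $\sigma_0,\sigma_1,\dots$ range over all sums of squares of polynomials in $(x,y,z)$, respectively in $(x,y)$ (with no bound on their degree). For multipliers $a\in\mathbb{R}$, $\phi\in C(\Omega)$, $\psi_i\in C(\Gamma_i)$ and $\theta\in C^1(\overline X\times\overline Y;\mathbb{R}^n)$ (that is, $\theta$ is $C^1$ on an open neighbourhood of $\overline X\times\overline Y$) define $$F:=l+af+\phi\, g+\nabla_x\cdot\theta+\operatorname{tr}[z\,D_y\theta]\ \text{ on }\Omega,\qquad G_i:=\psi_ih_i-\theta\cdot\hat n\ \text{ on }\Gamma_i,$$ where $D_y\theta=(\partial\theta_k/\partial y_j)_{k,j}$ is the $n\times m$ Jacobian, and put $$\mathbb{D}:=\sup_{a,\phi,\psi_i,\theta}\Big\{|X|\inf_\Omega F+\sum_{i=1}^s|\partial X_i|\inf_{\Gamma_i}G_i\Big\}.$$ For $d\in\mathbb{N}$ let $\mathbb{D}_d$ be the supremum of $$|X|\,b+\sum_{i=1}^s|\partial X_i|\,c_i$$ over $a,b,c_1,\dots,c_s\in\mathbb{R}$, $\phi\in\mathbb{R}[x,y,z]$ and $\psi_1,\dots,\psi_s,\theta_1,\dots,\theta_n\in\mathbb{R}[x,y]$,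 all of these polynomials having total degree at most $d$, such that $F-b\in Q(\Omega)$ and $G_i-c_i\in Q(\Gamma_i)$ for $i=1,\dots,s$. The values $\mathbb{D}$ and $\mathbb{D}_d$ are understood as extended real numbers. Suppose that $\overline X$, $\overline Y$ and $\overline Z$ are compact, and that there exist positive constants $C_0,\dots,C_s$ such that $C_0-\|x\|^2-\|y\|^2-\|z\|^2\in Q(\Omega)$ (with the Frobenius norm of $z$) and $C_i-\|x\|^2-\|y\|^2\in Q(\Gamma_i)$ for each $i=1,\dots,s$. Then $\mathbb{D}_d\to\mathbb{D}$ as $d\to\infty$. -/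

import Mathlib

open MeasureTheory Filter Topology

noncomputable section

namespace VarRelax

/-! ### Points, variables, polynomials -/

/-- Euclidean space `ℝᵏ`. -/
abbrev E (k : ℕ) : Type := EuclideanSpace ℝ (Fin k)

/-- Real `m × n` matrices, the values of the gradient variable `z`. -/
abbrev Mat (m n : ℕ) : Type := Matrix (Fin m) (Fin n) ℝ

/-- Labels of the scalar variables in `(x, y)`, with `x ∈ ℝⁿ` and `y ∈ ℝᵐ`. -/
abbrev VarXY (n m : ℕ) : Type := Fin n ⊕ Fin m

/-- Labels of the scalar variables in `(x, y, z)`, with `z ∈ ℝ^{m × n}`. -/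
abbrev VarXYZ (n m : ℕ) : Type := VarXY n m ⊕ (Fin m × Fin n)

/-- The polynomial ring `ℝ[x]`. -/
abbrev PolyX (n : ℕ) : Type := MvPolynomial (Fin n) ℝ

/-- The polynomial ring `ℝ[x, y]`. -/
abbrev PolyXY (n m : ℕ) : Type := MvPolynomial (VarXY n m) ℝ

/-- The polynomial ring `ℝ[x, y, z]`. -/
abbrev PolyXYZ (n m : ℕ) : Type := MvPolynomial (VarXYZ n m) ℝ

/-- The scalar coordinates of a point `(x, y)`. -/
def coordXY {n m : ℕ} (w : E n × E m) : VarXY n m → ℝ :=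
  Sum.elim (fun k => w.1 k) (fun j => w.2 j)

/-- The scalar coordinates of a point `(x, y, z)`. -/
def coordXYZ {n m : ℕ} (w : E n × E m × Mat m n) : VarXYZ n m → ℝ :=
  Sum.elim (coordXY (w.1, w.2.1)) (fun jk => w.2.2 jk.1 jk.2)

/-- The function of `(x, y)` defined by a polynomial in `ℝ[x, y]`. -/
def evalXY {n m : ℕ} (p : PolyXY n m) (w : E n × E m) : ℝ :=
  MvPolynomial.eval (coordXY w) p

/-- The function of `(x, y, z)` defined by a polynomial in `ℝ[x, y, z]`. -/
def evalXYZ {n m : ℕ} (p : PolyXYZ n m) (w : E n × E m × Mat m n) : ℝ :=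
  MvPolynomial.eval (coordXYZ w) p

/-- The vector field on `ℝⁿ` whose components are polynomials in `x`. -/
def evalField {n : ℕ} (N : Fin n → PolyX n) (x : E n) : E n :=
  WithLp.toLp 2 (fun k => MvPolynomial.eval (fun j => x j) (N k))

/-! ### The spatial domain, its boundary pieces and the outward normal -/

/-- `X` has Lipschitz boundary: near every boundary point, `X` is the strict epigraph, in some unit
direction `e`, of a Lipschitz function of the component of the point orthogonal to `e`. -/
def HasLipschitzBoundary {n : ℕ} (X : Set (E n)) : Prop :=
  ∀ x₀ ∈ frontier X, ∃ (e : E n) (K : NNReal) (γ : E n → ℝ) (U : Set (E n)),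
    ‖e‖ = 1 ∧ LipschitzWith K γ ∧ IsOpen U ∧ x₀ ∈ U ∧
      ∀ y ∈ U, (y ∈ X ↔ γ (y - inner ℝ e y • e) < inner ℝ e y)

/-- `ρ` is a smooth defining function, on the open neighbourhood `U` of `x`, of the domain `X` and
of the boundary piece `S`: `X = {ρ < 0}` and `S = {ρ = 0}` in `U`, and `∇ρ(x) ≠ 0`. -/
structure IsDefiningFunction {n : ℕ} (X S : Set (E n)) (x : E n) (U : Set (E n)) (ρ : E n → ℝ) :
    Prop where
  isOpen : IsOpen U
  mem : x ∈ U
  smooth : ContDiffOn ℝ ((⊤ : ℕ∞) : WithTop ℕ∞) ρ U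
  domain_iff : ∀ y ∈ U, (y ∈ X ↔ ρ y < 0)
  piece_iff : ∀ y ∈ U, (y ∈ S ↔ ρ y = 0)
  gradient_ne : gradient ρ x ≠ 0

/-- The points of the boundary piece `S` near which `S` is all of `∂X` and is a smooth
hypersurface with `X` on one side. -/
def smoothPoints {n : ℕ} (X S : Set (E n)) : Set (E n) :=
  {x | x ∈ S ∧ ∃ U ρ, IsDefiningFunction X S x U ρ}

/-- The `(n-1)`-dimensional surface measure on `ℝⁿ` (normalized Hausdorff measure). -/
def surfaceMeasure (n : ℕ) : Measure (E n) := Measure.euclideanHausdorffMeasure (n - 1)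

/-- `X` is a bounded domain in `ℝⁿ` with Lipschitz boundary, and its boundary is made of the
smooth surfaces `S 1, …, S s`, which are disjoint up to sets of zero surface measure. The surfaces
are smooth away from their edges, which are limits of smooth points and have zero surface measure. -/
structure IsPiecewiseSmoothDomain {n s : ℕ} (X : Set (E n)) (S : Fin s → Set (E n)) : Prop where
  isOpen : IsOpen X
  isConnected : IsConnected X
  isBounded : Bornology.IsBounded X
  lipschitz : HasLipschitzBoundary X
  boundary_eq : frontier X = ⋃ i, S i
  disjoint : ∀ i j, i ≠ j → surfaceMeasure n (S i ∩ S j) = 0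
  dense_smooth : ∀ i, S i ⊆ closure (smoothPoints X (S i))
  null_edges : ∀ i, surfaceMeasure n (S i \ smoothPoints X (S i)) = 0

/-- `ν` is the outward unit normal to `∂X` along the piece `S`: it is `∇ρ / ‖∇ρ‖` at the smooth
points of `S`, and is extended continuously to the edges of `S`. -/
def IsOutwardUnitNormal {n : ℕ} (X S : Set (E n)) (ν : E n → E n) : Prop :=
  ContinuousOn ν S ∧ ∀ x ∈ S, ∀ U ρ, IsDefiningFunction X S x U ρ →
    ν x = ‖gradient ρ x‖⁻¹ • gradient ρ x

/-! ### The convex program over Lagrange multipliers -/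

/-- `Ω = X̄ × Ȳ × Z̄`. -/
def Omega {n m : ℕ} (X : Set (E n)) (Y : Set (E m)) (Z : Set (Mat m n)) :
    Set (E n × E m × Mat m n) :=
  closure X ×ˢ closure Y ×ˢ closure Z

/-- `Γ = S × Ȳ` for a boundary piece `S`. -/
def Gamma {n m : ℕ} (S : Set (E n)) (Y : Set (E m)) : Set (E n × E m) :=
  S ×ˢ closure Y

/-- `θ` is a `C¹` vector field on `X̄ × Ȳ`: it is defined and `C¹` on an open neighbourhood. -/
def IsC1On {n m : ℕ} (X : Set (E n)) (Y : Set (E m)) (θ : E n × E m → E n) : Prop :=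
  ∃ U : Set (E n × E m), IsOpen U ∧ closure X ×ˢ closure Y ⊆ U ∧ ContDiffOn ℝ 1 θ U

/-- The divergence `∇ₓ · θ` of `θ` with respect to `x`. -/
def divX {n m : ℕ} (θ : E n × E m → E n) (w : E n × E m) : ℝ :=
  ∑ k : Fin n, (fderiv ℝ θ w (EuclideanSpace.single k 1, 0)) k

/-- The `n × m` Jacobian matrix `D_y θ = (∂θₖ/∂yⱼ)` of `θ` with respect to `y`. -/
def jacY {n m : ℕ} (θ : E n × E m → E n) (w : E n × E m) : Matrix (Fin n) (Fin m) ℝ :=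
  Matrix.of fun k j => (fderiv ℝ θ w (0, EuclideanSpace.single j 1)) k

/-- `F = l + a f + φ g + ∇ₓ · θ + tr (z D_y θ)`. -/
def bulkF {n m : ℕ} (l f g : E n × E m × Mat m n → ℝ) (a : ℝ) (φ : E n × E m × Mat m n → ℝ)
    (θ : E n × E m → E n) (w : E n × E m × Mat m n) : ℝ :=
  l w + a * f w + φ w * g w + divX θ (w.1, w.2.1) + Matrix.trace (w.2.2 * jacY θ (w.1, w.2.1))

/-- `G = ψ h - θ · ν`. -/
def boundaryG {n m : ℕ} (h : E n × E m → ℝ) (ν : E n → E n) (ψ : E n × E m → ℝ)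
    (θ : E n × E m → E n) (w : E n × E m) : ℝ :=
  ψ w * h w - inner ℝ (θ w) (ν w.1)

/-- The optimal value `𝔻` of the Lagrange multiplier program, as an extended real number: the
supremum of `|X| inf_Ω F + ∑ᵢ |∂Xᵢ| inf_{Γᵢ} Gᵢ` over `a ∈ ℝ`, `φ ∈ C(Ω)`, `ψᵢ ∈ C(Γᵢ)` and
`θ ∈ C¹(X̄ × Ȳ; ℝⁿ)`. -/
def dualValue {n m s : ℕ} (X : Set (E n)) (S : Fin s → Set (E n)) (Y : Set (E m))
    (Z : Set (Mat m n)) (l f g : E n × E m × Mat m n → ℝ) (h : Fin s → E n × E m → ℝ)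
    (ν : Fin s → E n → E n) : EReal :=
  sSup {v : EReal | ∃ (a : ℝ) (φ : E n × E m × Mat m n → ℝ) (ψ : Fin s → E n × E m → ℝ)
      (θ : E n × E m → E n),
    ContinuousOn φ (Omega X Y Z) ∧
    (∀ i, ContinuousOn (ψ i) (Gamma (S i) Y)) ∧
    IsC1On X Y θ ∧
    v = ((volume X).toReal : EReal) * (⨅ w ∈ Omega X Y Z, (bulkF l f g a φ θ w : EReal)) +
      ∑ i, ((surfaceMeasure n (S i)).toReal : EReal) *
        (⨅ w ∈ Gamma (S i) Y, (boundaryG (h i) (ν i) (ψ i) θ w : EReal))}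

/-! ### Weighted sums of squares and the strengthened programs -/

/-- The polynomials `σ₀ + σ₁ p₁ + ⋯ + σᵣ pᵣ` with all `σⱼ` sums of squares of polynomials. -/
def weightedSOS {V : Type*} {r : ℕ} (p : Fin r → MvPolynomial V ℝ) : Set (MvPolynomial V ℝ) :=
  {w | ∃ (σ₀ : MvPolynomial V ℝ) (σ : Fin r → MvPolynomial V ℝ),
    IsSumSq σ₀ ∧ (∀ j, IsSumSq (σ j)) ∧ w = σ₀ + ∑ j, σ j * p j}

/-- The squared Euclidean norm of the point with coordinates the variables, as a polynomial. -/
def normSqPoly (V : Type*) [Fintype V] : MvPolynomial V ℝ := ∑ v, MvPolynomial.X v ^ 2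

/-- A polynomial in `(x, y)` regarded as a polynomial in `(x, y, z)`. -/
def liftXY {n m : ℕ} (p : PolyXY n m) : PolyXYZ n m := MvPolynomial.rename Sum.inl p

/-- A polynomial in `x` regarded as a polynomial in `(x, y)`. -/
def liftX {n : ℕ} (m : ℕ) (p : PolyX n) : PolyXY n m := MvPolynomial.rename Sum.inl p

/-- The polynomial `∇ₓ · θ` for polynomial `θ`. -/
def divXPoly {n m : ℕ} (θ : Fin n → PolyXY n m) : PolyXY n m :=
  ∑ k, MvPolynomial.pderiv (Sum.inl k) (θ k)

/-- The polynomial matrix `D_y θ = (∂θₖ/∂yⱼ)` for polynomial `θ`. -/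
def jacYPoly {n m : ℕ} (θ : Fin n → PolyXY n m) : Matrix (Fin n) (Fin m) (PolyXY n m) :=
  Matrix.of fun k j => MvPolynomial.pderiv (Sum.inr j) (θ k)

/-- The matrix `z` of variables. -/
def zPoly (n m : ℕ) : Matrix (Fin m) (Fin n) (PolyXYZ n m) :=
  Matrix.of fun j k => MvPolynomial.X (Sum.inr (j, k))

/-- `F` as a polynomial. -/
def bulkFPoly {n m : ℕ} (l f g : PolyXYZ n m) (a : ℝ) (φ : PolyXYZ n m)
    (θ : Fin n → PolyXY n m) : PolyXYZ n m :=
  l + MvPolynomial.C a * f + φ * g + liftXY (divXPoly θ) +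
    Matrix.trace (zPoly n m * (jacYPoly θ).map liftXY)

/-- `G` as a polynomial. -/
def boundaryGPoly {n m : ℕ} (h : PolyXY n m) (ν : Fin n → PolyX n) (ψ : PolyXY n m)
    (θ : Fin n → PolyXY n m) : PolyXY n m :=
  ψ * h - ∑ k, θ k * liftX m (ν k)

/-- The optimal value of the weighted-SOS strengthening in which the multipliers `φ`, `ψᵢ`, `θₖ`
are polynomials of degree at most `d`: the supremum of `|X| b + ∑ᵢ |∂Xᵢ| cᵢ` subject to
`F - b ∈ Q(Ω)` and `Gᵢ - cᵢ ∈ Q(Γᵢ)`. -/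
def sosValue {n m s : ℕ} (X : Set (E n)) (S : Fin s → Set (E n))
    (l f g : PolyXYZ n m) (h : Fin s → PolyXY n m) (ν : Fin s → Fin n → PolyX n)
    {r : ℕ} (p : Fin r → PolyXYZ n m) {t : Fin s → ℕ} (q : ∀ i, Fin (t i) → PolyXY n m)
    (d : ℕ) : EReal :=
  sSup {v : EReal | ∃ (a b : ℝ) (c : Fin s → ℝ) (φ : PolyXYZ n m) (ψ : Fin s → PolyXY n m)
      (θ : Fin n → PolyXY n m),
    φ.totalDegree ≤ d ∧ (∀ i, (ψ i).totalDegree ≤ d) ∧ (∀ k, (θ k).totalDegree ≤ d) ∧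
    bulkFPoly l f g a φ θ - MvPolynomial.C b ∈ weightedSOS p ∧
    (∀ i, boundaryGPoly (h i) (ν i) (ψ i) θ - MvPolynomial.C (c i) ∈ weightedSOS (q i)) ∧
    v = (((volume X).toReal * b + ∑ i, (surfaceMeasure n (S i)).toReal * c i : ℝ) : EReal)}

end VarRelax

end

/-!
# Convergence of the weighted sum-of-squares strengthenings

The optimal values `𝔻_d` increase with `d`, so they converge to their supremum, and it remains to
compare that supremum with `𝔻`.

*Upper bound* (`sosValue_le_dualValue`). Polynomial multipliers are admissible in the program that
defines `𝔻`, and an element of `Q(Ω)` or `Q(Γᵢ)` is nonnegative on the corresponding set, so `b` and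
`cᵢ` are lower bounds of `F` and `Gᵢ`.

*Lower bound* (`dualValue_le_iSup_sosValue`). Let `(a, φ, ψ, θ)` be admissible in the program for `𝔻`
and `ε > 0`. All sets involved are compact, so Weierstrass approximation of `φ` and `ψᵢ`, and
approximation of `θ` together with its first derivatives, yield polynomial multipliers that change
`F` and `Gᵢ` by less than `ε` (`exists_polynomial_multipliers`). The resulting polynomials exceed
`inf F - ε` on `Ω` and `inf Gᵢ - ε` on `Γᵢ` *strictly*, and Putinar's Positivstellensatz
(`mem_weightedSOS_of_forall_pos`) puts the differences in `Q(Ω)` and `Q(Γᵢ)`. The value lost is `ε`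
times a constant.

Two general facts carry the lower bound.

* Putinar's theorem, in the form of the representation theorem for an archimedean quadratic module
  `M` in a commutative `ℝ`-algebra (`IsQuadraticModule.mem_of_forall_pos`). A maximal proper module
  is a total preorder, whose standard part map is a character. Hence if `f` is positive under all
  characters nonnegative on `M`, then `-1 ∈ M - Σ A² f`, that is, `σ f - 1 ∈ M` for a sum of squares
  `σ`; an identity due to Wörmann then improves a bound `f + r ∈ M` by a fixed amount, until `r` is
  negative. A bound on `‖x‖²` makes the module archimedean (`isArchimedean_of_normSqPoly`).

* Polynomial approximation in `C¹` on a compact set (`exists_eval_near_contDiffOn`). After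
  multiplication by a cutoff, the function is compactly supported, and its convolution with a power of
  `N - ‖y‖²` is a polynomial. Suitably normalized, these powers act as peak functions, on the
  function and on its derivative alike.
-/

/-! ### Archimedean quadratic modules and positivity -/

namespace QuadraticModule

/-- `M` is a quadratic module: it contains `1` and is closed under addition and under multiplication
by squares. Properness `-1 ∉ M` is not required. -/
structure IsQuadraticModule {A : Type*} [CommRing A] (M : Set A) : Prop where
  one_mem : (1 : A) ∈ M
  add_mem : ∀ {a b : A}, a ∈ M → b ∈ M → a + b ∈ M
  sq_mul_mem : ∀ (a : A) {b : A}, b ∈ M → a ^ 2 * b ∈ M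

section Ring

variable {A : Type*} [CommRing A] {M : Set A}

theorem IsQuadraticModule.sq_mem (hM : IsQuadraticModule M) (a : A) : a ^ 2 ∈ M := by
  simpa using hM.sq_mul_mem a hM.one_mem

theorem IsQuadraticModule.zero_mem (hM : IsQuadraticModule M) : (0 : A) ∈ M := by
  simpa using hM.sq_mem 0

theorem IsQuadraticModule.sumSq_mul_mem (hM : IsQuadraticModule M) {s : A} (hs : IsSumSq s) {a : A}
    (ha : a ∈ M) : s * a ∈ M := by
  induction hs with
  | zero => simpa using hM.zero_mem
  | sq_add b _ ih =>
    rw [add_mul, ← pow_two]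
    exact hM.add_mem (hM.sq_mul_mem b ha) ih

theorem IsQuadraticModule.sumSq_mem (hM : IsQuadraticModule M) {s : A} (hs : IsSumSq s) : s ∈ M := by
  simpa using hM.sumSq_mul_mem hs hM.one_mem

theorem isSumSq_sq_mul (a : A) {s : A} (hs : IsSumSq s) : IsSumSq (a ^ 2 * s) :=
  (IsSquare.sq a).isSumSq.mul hs

/-- The quadratic module `M + Σ A² · a` generated by `M` and `a`. -/
def adjoin (M : Set A) (a : A) : Set A := {x | ∃ m ∈ M, ∃ s, IsSumSq s ∧ x = m + s * a}

theorem IsQuadraticModule.adjoin (hM : IsQuadraticModule M) (a : A) :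
    IsQuadraticModule (adjoin M a) where
  one_mem := ⟨1, hM.one_mem, 0, .zero, by simp⟩
  add_mem := by
    rintro _ _ ⟨m, hm, s, hs, rfl⟩ ⟨m', hm', s', hs', rfl⟩
    exact ⟨m + m', hM.add_mem hm hm', s + s', hs.add hs', by ring⟩
  sq_mul_mem := by
    rintro b _ ⟨m, hm, s, hs, rfl⟩
    exact ⟨b ^ 2 * m, hM.sq_mul_mem b hm, b ^ 2 * s, isSumSq_sq_mul b hs, by ring⟩

theorem subset_adjoin (a : A) : M ⊆ adjoin M a :=
  fun m hm => ⟨m, hm, 0, .zero, by simp⟩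

theorem IsQuadraticModule.mem_adjoin (hM : IsQuadraticModule M) (a : A) :
    a ∈ QuadraticModule.adjoin M a :=
  ⟨0, hM.zero_mem, 1, IsSumSq.one, by simp⟩

/-- `M` is maximal among the proper quadratic modules. -/
structure IsMaximal (M : Set A) : Prop where
  isQuadraticModule : IsQuadraticModule M
  neg_one_notMem : (-1 : A) ∉ M
  neg_one_mem_adjoin : ∀ a ∉ M, (-1 : A) ∈ adjoin M a

/-- Every proper quadratic module lies in a maximal one. -/
theorem IsQuadraticModule.exists_isMaximal (hM : IsQuadraticModule M) (h1 : (-1 : A) ∉ M) :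
    ∃ P, M ⊆ P ∧ IsMaximal P := by
  obtain ⟨P, hMP, hP⟩ := zorn_subset_nonempty {P : Set A | IsQuadraticModule P ∧ (-1 : A) ∉ P}
    (fun c hc hchain hne => by
      refine ⟨⋃₀ c, ⟨⟨?_, ?_, ?_⟩, ?_⟩, fun s hs => Set.subset_sUnion_of_mem hs⟩
      · obtain ⟨s, hs⟩ := hne
        exact ⟨s, hs, (hc hs).1.one_mem⟩
      · rintro a b ⟨s, hs, ha⟩ ⟨t, ht, hb⟩
        rcases hchain.total hs ht with h | h
        · exact ⟨t, ht, (hc ht).1.add_mem (h ha) hb⟩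
        · exact ⟨s, hs, (hc hs).1.add_mem ha (h hb)⟩
      · rintro a b ⟨s, hs, hb⟩
        exact ⟨s, hs, (hc hs).1.sq_mul_mem a hb⟩
      · rintro ⟨s, hs, h⟩
        exact (hc hs).2 h) M ⟨hM, h1⟩
  refine ⟨P, hMP, hP.prop.1, hP.prop.2, fun a ha => ?_⟩
  by_contra h
  exact ha (hP.le_of_ge ⟨hP.prop.1.adjoin a, h⟩ (subset_adjoin a) (hP.prop.1.mem_adjoin a))

end Ring

section Algebra

variable {A : Type*} [CommRing A] [Algebra ℝ A] {M : Set A}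

theorem IsQuadraticModule.algebraMap_mul_mem (hM : IsQuadraticModule M) {r : ℝ} (hr : 0 ≤ r) {a : A}
    (ha : a ∈ M) : algebraMap ℝ A r * a ∈ M := by
  have := hM.sq_mul_mem (algebraMap ℝ A (√r)) ha
  rwa [← map_pow, Real.sq_sqrt hr] at this

theorem IsQuadraticModule.algebraMap_mem (hM : IsQuadraticModule M) {r : ℝ} (hr : 0 ≤ r) :
    algebraMap ℝ A r ∈ M := by
  simpa using hM.algebraMap_mul_mem hr hM.one_mem

theorem IsQuadraticModule.of_algebraMap_mul_mem (hM : IsQuadraticModule M) {r : ℝ} (hr : 0 < r)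
    {a : A} (ha : algebraMap ℝ A r * a ∈ M) : a ∈ M := by
  have := hM.algebraMap_mul_mem (inv_nonneg.2 hr.le) ha
  rwa [← mul_assoc, ← map_mul, inv_mul_cancel₀ hr.ne', map_one, one_mul] at this

theorem IsQuadraticModule.nonneg_of_algebraMap_mem (hM : IsQuadraticModule M) (h1 : (-1 : A) ∉ M)
    {r : ℝ} (h : algebraMap ℝ A r ∈ M) : 0 ≤ r := by
  by_contra! hr
  refine h1 (hM.of_algebraMap_mul_mem (neg_pos.2 hr) ?_)
  simpa using h

/-- `-r ≤ a ≤ r` for the preorder defined by `M`. -/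
def IsBoundedBy (M : Set A) (r : ℝ) (a : A) : Prop :=
  algebraMap ℝ A r - a ∈ M ∧ algebraMap ℝ A r + a ∈ M

theorem IsBoundedBy.add (hM : IsQuadraticModule M) {r s : ℝ} {a b : A} (ha : IsBoundedBy M r a)
    (hb : IsBoundedBy M s b) : IsBoundedBy M (r + s) (a + b) := by
  constructor
  · convert! hM.add_mem ha.1 hb.1 using 1
    rw [map_add]; ring
  · convert! hM.add_mem ha.2 hb.2 using 1
    rw [map_add]; ring

theorem IsBoundedBy.neg {r : ℝ} {a : A} (ha : IsBoundedBy M r a) :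
    IsBoundedBy M r (-a) :=
  ⟨by simpa using ha.2, by simpa [sub_eq_add_neg] using ha.1⟩

theorem IsBoundedBy.sub (hM : IsQuadraticModule M) {r s : ℝ} {a b : A} (ha : IsBoundedBy M r a)
    (hb : IsBoundedBy M s b) : IsBoundedBy M (r + s) (a - b) :=
  sub_eq_add_neg a b ▸ ha.add hM hb.neg

/-- A quadratic module need not be closed under products, so this rests on the identity
`2 r (r² - a²) = (r + a)² (r - a) + (r - a)² (r + a)`. -/
theorem IsBoundedBy.sq_sub_sq_mem (hM : IsQuadraticModule M) {r : ℝ} (hr : 0 < r) {a : A}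
    (ha : IsBoundedBy M r a) : algebraMap ℝ A (r ^ 2) - a ^ 2 ∈ M := by
  refine hM.of_algebraMap_mul_mem (mul_pos two_pos hr) ?_
  convert! hM.add_mem (hM.sq_mul_mem (algebraMap ℝ A r + a) ha.1)
    (hM.sq_mul_mem (algebraMap ℝ A r - a) ha.2) using 1
  simp only [map_mul, map_pow, map_ofNat]
  ring

theorem IsBoundedBy.mul (hM : IsQuadraticModule M) {r s : ℝ} (hr : 0 < r) (hs : 0 < s) {a b : A}
    (ha : IsBoundedBy M r a) (hb : IsBoundedBy M s b) :
    IsBoundedBy M ((r + s) ^ 2 / 4) (a * b) := by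
  have h4 : (4 : A) * algebraMap ℝ A ((r + s) ^ 2 / 4) = algebraMap ℝ A ((r + s) ^ 2) := by
    rw [← map_ofNat (algebraMap ℝ A) 4, ← map_mul]
    congr 1
    ring
  constructor
  · refine hM.of_algebraMap_mul_mem (r := 4) (by norm_num) ?_
    convert! hM.add_mem ((ha.add hM hb).sq_sub_sq_mem hM (add_pos hr hs)) (hM.sq_mem (a - b)) using 1
    rw [map_ofNat, mul_sub, h4]
    ring
  · refine hM.of_algebraMap_mul_mem (r := 4) (by norm_num) ?_
    convert! hM.add_mem ((ha.sub hM hb).sq_sub_sq_mem hM (add_pos hr hs)) (hM.sq_mem (a + b)) using 1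
    rw [map_ofNat, mul_add, h4]
    ring

/-- `M` is archimedean: `1` is an order unit for the preorder defined by `M`. -/
def IsArchimedean (M : Set A) : Prop := ∀ a : A, ∃ r : ℝ, algebraMap ℝ A r - a ∈ M

theorem IsArchimedean.mono {N : Set A} (hM : IsArchimedean M) (h : M ⊆ N) : IsArchimedean N :=
  fun a => (hM a).imp fun _ hr => h hr

/-- A maximal proper quadratic module defines a total preorder. -/
theorem IsMaximal.mem_or_neg_mem (hM : IsMaximal M) (a : A) : a ∈ M ∨ -a ∈ M := by
  have hQ := hM.isQuadraticModule
  by_contra! h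
  obtain ⟨m₁, hm₁, s₁, hs₁, e₁⟩ := hM.neg_one_mem_adjoin a h.1
  obtain ⟨m₂, hm₂, s₂, hs₂, e₂⟩ := hM.neg_one_mem_adjoin (-a) h.2
  -- Eliminating `a` between the two representations of `-1` gives `-s₁ - s₂ ∈ M`.
  have hsum : -s₁ - s₂ ∈ M := by
    convert! hQ.add_mem (hQ.sumSq_mul_mem hs₂ hm₁) (hQ.sumSq_mul_mem hs₁ hm₂) using 1
    linear_combination s₂ * e₁ + s₁ * e₂
  have hs₁neg : -s₁ ∈ M := by
    convert! hQ.add_mem hsum (hQ.sumSq_mem hs₂) using 1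
    ring
  -- As `±s₁ ∈ M` and `4 a = (a + 1)² - (a - 1)²`, also `s₁ a ∈ M`.
  have hmul : s₁ * a ∈ M := by
    refine hQ.of_algebraMap_mul_mem (r := 4) (by norm_num) ?_
    convert! hQ.add_mem (hQ.sumSq_mul_mem hs₁ (hQ.sq_mem (a + 1)))
      (hQ.sq_mul_mem (a - 1) hs₁neg) using 1
    rw [map_ofNat]
    ring
  exact hM.neg_one_notMem (e₁ ▸ hQ.add_mem hm₁ hmul)

/-- `a` is infinitesimally close to `0` for the preorder defined by `M`. -/
def IsInfinitesimal (M : Set A) (a : A) : Prop := ∀ ε > 0, IsBoundedBy M ε a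

theorem IsInfinitesimal.add (hM : IsQuadraticModule M) {a b : A} (ha : IsInfinitesimal M a)
    (hb : IsInfinitesimal M b) : IsInfinitesimal M (a + b) := fun ε hε => by
  simpa using (ha (ε / 2) (half_pos hε)).add hM (hb (ε / 2) (half_pos hε))

theorem IsInfinitesimal.neg {a : A} (ha : IsInfinitesimal M a) : IsInfinitesimal M (-a) :=
  fun ε hε => (ha ε hε).neg

theorem IsInfinitesimal.algebraMap_mul (hM : IsQuadraticModule M) (r : ℝ) {a : A}
    (ha : IsInfinitesimal M a) : IsInfinitesimal M (algebraMap ℝ A r * a) := fun ε hε => by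
  have hR : 0 < |r| + 1 := by positivity
  have hrR : |r| ≤ |r| + 1 := by linarith
  -- `(R ∓ r) (δ ± a) + (R ± r) (δ ∓ a) = 2 R δ ∓ 2 r a`, with `R = |r| + 1` and `δ = ε / R`.
  obtain ⟨h₁, h₂⟩ := ha (ε / (|r| + 1)) (by positivity)
  have hp : 0 ≤ |r| + 1 + r := by linarith [neg_abs_le r]
  have hm : 0 ≤ |r| + 1 - r := by linarith [le_abs_self r]
  have he : algebraMap ℝ A ε = algebraMap ℝ A (|r| + 1) * algebraMap ℝ A (ε / (|r| + 1)) := by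
    rw [← map_mul, mul_div_cancel₀ _ hR.ne']
  constructor
  · refine hM.of_algebraMap_mul_mem two_pos ?_
    convert! hM.add_mem (hM.algebraMap_mul_mem hp h₁) (hM.algebraMap_mul_mem hm h₂) using 1
    rw [he, map_ofNat, map_add _ _ r, map_sub _ _ r]
    ring
  · refine hM.of_algebraMap_mul_mem two_pos ?_
    convert! hM.add_mem (hM.algebraMap_mul_mem hm h₁) (hM.algebraMap_mul_mem hp h₂) using 1
    rw [he, map_ofNat, map_add _ _ r, map_sub _ _ r]
    ring

theorem IsInfinitesimal.mul (hM : IsQuadraticModule M) {a b : A} (ha : IsInfinitesimal M a)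
    (hb : IsInfinitesimal M b) : IsInfinitesimal M (a * b) := fun ε hε => by
  have hs := Real.sqrt_pos.2 hε
  convert! (ha _ hs).mul hM hs hs (hb _ hs) using 1
  nlinarith [Real.sq_sqrt hε.le]

theorem IsMaximal.exists_isInfinitesimal_sub (hM : IsMaximal M) (hA : IsArchimedean M) (a : A) :
    ∃ r : ℝ, IsInfinitesimal M (a - algebraMap ℝ A r) := by
  have hQ := hM.isQuadraticModule
  let s : Set ℝ := {r | a - algebraMap ℝ A r ∈ M}
  have hne : s.Nonempty := by
    obtain ⟨r, hr⟩ := hA (-a)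
    refine ⟨-r, ?_⟩
    simpa [s, add_comm] using hr
  have hbdd : BddAbove s := by
    obtain ⟨R, hR⟩ := hA a
    refine ⟨R, fun r hr => sub_nonneg.1 (hQ.nonneg_of_algebraMap_mem hM.neg_one_notMem ?_)⟩
    convert! hQ.add_mem hR hr using 1
    rw [map_sub]; ring
  refine ⟨sSup s, fun ε hε => ⟨?_, ?_⟩⟩
  · have : a - algebraMap ℝ A (sSup s + ε) ∉ M := fun h => by
      linarith [le_csSup hbdd (show sSup s + ε ∈ s from h)]
    convert! (hM.mem_or_neg_mem _).resolve_left this using 1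
    rw [map_add]; ring
  · obtain ⟨r, hr, hlt⟩ := exists_lt_of_lt_csSup hne (sub_lt_self (sSup s) hε)
    convert! hQ.add_mem hr (hQ.algebraMap_mem (sub_nonneg.2 hlt.le)) using 1
    simp only [map_sub]; ring

theorem IsMaximal.eq_of_isInfinitesimal_sub (hM : IsMaximal M) {a : A} {r s : ℝ}
    (hr : IsInfinitesimal M (a - algebraMap ℝ A r)) (hs : IsInfinitesimal M (a - algebraMap ℝ A s)) :
    r = s := by
  have hQ := hM.isQuadraticModule
  have key : IsInfinitesimal M (algebraMap ℝ A (r - s)) := by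
    convert! hs.add hQ hr.neg using 1
    rw [map_sub]; ring
  refine le_antisymm (le_of_forall_pos_le_add fun ε hε => ?_) (le_of_forall_pos_le_add fun ε hε => ?_)
  · have := hQ.nonneg_of_algebraMap_mem hM.neg_one_notMem (by simpa only [← map_sub] using (key ε hε).1)
    linarith
  · have := hQ.nonneg_of_algebraMap_mem hM.neg_one_notMem (by simpa only [← map_add] using (key ε hε).2)
    linarith

/-- A maximal proper archimedean quadratic module is nonnegative under some real character: the
standard part map of the total preorder it defines. -/
theorem IsMaximal.exists_algHom (hM : IsMaximal M) (hA : IsArchimedean M) :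
    ∃ φ : A →ₐ[ℝ] ℝ, ∀ a ∈ M, 0 ≤ φ a := by
  have hQ := hM.isQuadraticModule
  choose φ hφ using hM.exists_isInfinitesimal_sub hA
  have hconst : ∀ r, φ (algebraMap ℝ A r) = r := fun r =>
    hM.eq_of_isInfinitesimal_sub (hφ _) fun ε hε => by
      simpa [IsBoundedBy] using hQ.algebraMap_mem hε.le
  have hadd : ∀ a b, φ (a + b) = φ a + φ b := fun a b =>
    hM.eq_of_isInfinitesimal_sub (hφ _) <| by
      convert! (hφ a).add hQ (hφ b) using 1
      rw [map_add]; ring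
  have hmul : ∀ a b, φ (a * b) = φ a * φ b := fun a b =>
    hM.eq_of_isInfinitesimal_sub (hφ _) <| by
      convert! (((hφ a).mul hQ (hφ b)).add hQ ((hφ b).algebraMap_mul hQ (φ a))).add hQ
        ((hφ a).algebraMap_mul hQ (φ b)) using 1
      rw [map_mul]; ring
  refine ⟨{ toFun := φ, map_one' := ?_, map_mul' := hmul, map_zero' := ?_, map_add' := hadd,
            commutes' := hconst }, fun a ha => ?_⟩
  · simpa using hconst 1
  · simpa using hconst 0
  · change 0 ≤ φ a
    refine le_of_forall_pos_le_add fun ε hε => ?_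
    refine hQ.nonneg_of_algebraMap_mem hM.neg_one_notMem ?_
    convert! hQ.add_mem ha (hφ a ε hε).1 using 1
    rw [map_add]; ring

/-- The representation theorem for archimedean quadratic modules: an element that is positive under
every character nonnegative on `M` belongs to `M`. -/
theorem IsQuadraticModule.mem_of_forall_pos (hM : IsQuadraticModule M) (hA : IsArchimedean M) {f : A}
    (hf : ∀ φ : A →ₐ[ℝ] ℝ, (∀ a ∈ M, 0 ≤ φ a) → 0 < φ f) : f ∈ M := by
  -- `M` and `-f` generate an improper module, as a maximal one above them would carry a character.
  have hneg : (-1 : A) ∈ QuadraticModule.adjoin M (-f) := by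
    by_contra h
    obtain ⟨P, hP, hPmax⟩ := (hM.adjoin (-f)).exists_isMaximal h
    obtain ⟨φ, hφ⟩ := hPmax.exists_algHom (hA.mono ((subset_adjoin _).trans hP))
    have h₁ := hf φ fun a ha => hφ a (hP (subset_adjoin _ ha))
    have h₂ := hφ _ (hP (hM.mem_adjoin (-f)))
    rw [map_neg] at h₂
    linarith
  obtain ⟨m, hm, σ, hσ, e⟩ := hneg
  have hσf : σ * f - 1 ∈ M := by
    convert! hm using 1
    linear_combination e
  obtain ⟨k, hk, hk₁, hk₂⟩ : ∃ k : ℝ, 0 < k ∧ 2 * algebraMap ℝ A k - σ ∈ M ∧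
      2 * algebraMap ℝ A k - σ ^ 2 * f - 1 ∈ M := by
    obtain ⟨k₁, hk₁⟩ := hA σ
    obtain ⟨k₂, hk₂⟩ := hA (σ ^ 2 * f + 1)
    have e2 : (2 : A) = algebraMap ℝ A 2 := (map_ofNat _ 2).symm
    refine ⟨|k₁| + |k₂| + 1, by positivity, ?_, ?_⟩
    · convert! hM.add_mem hk₁ (hM.algebraMap_mem (r := 2 * (|k₁| + |k₂| + 1) - k₁)
        (by linarith [le_abs_self k₁, abs_nonneg k₁, abs_nonneg k₂])) using 1
      rw [map_sub, map_mul, ← e2]; ring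
    · convert! hM.add_mem hk₂ (hM.algebraMap_mem (r := 2 * (|k₁| + |k₂| + 1) - k₂)
        (by linarith [le_abs_self k₂, abs_nonneg k₁, abs_nonneg k₂])) using 1
      rw [map_sub, map_mul, ← e2]; ring
  -- A lower bound `-r ≤ f` can be improved by the fixed amount `k⁻²`, because `k² (f + r) - 1` equals
  -- `(k - σ)² (f + r) + 2 k (σ f - 1) + r σ (2 k - σ) + (2 k - σ² f - 1)`.
  have step : ∀ r : ℝ, 0 ≤ r → f + algebraMap ℝ A r ∈ M →
      f + algebraMap ℝ A (r - (k ^ 2)⁻¹) ∈ M := fun r hr h => by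
    refine hM.of_algebraMap_mul_mem (pow_pos hk 2) ?_
    have hc : algebraMap ℝ A k ^ 2 * algebraMap ℝ A ((k ^ 2)⁻¹) = 1 := by
      rw [← map_pow, ← map_mul, mul_inv_cancel₀ (pow_pos hk 2).ne', map_one]
    convert! hM.add_mem (hM.add_mem (hM.add_mem (hM.sq_mul_mem (algebraMap ℝ A k - σ) h)
      (hM.algebraMap_mul_mem (mul_pos two_pos hk).le hσf))
      (hM.algebraMap_mul_mem hr (hM.sumSq_mul_mem hσ hk₁))) hk₂ using 1
    simp only [map_sub, map_mul, map_pow, map_ofNat]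
    linear_combination -hc
  have iter : ∀ j : ℕ, ∀ r : ℝ, r ≤ j * (k ^ 2)⁻¹ → f + algebraMap ℝ A r ∈ M → f ∈ M := by
    intro j
    induction j with
    | zero =>
      intro r hr h
      convert! hM.add_mem h (hM.algebraMap_mem (r := -r) (by simpa using hr)) using 1
      rw [map_neg]; ring
    | succ j ih =>
      intro r hr h
      rcases le_total 0 r with h0 | h0
      · refine ih (r - (k ^ 2)⁻¹) ?_ (step r h0 h)
        push_cast at hr
        linarith
      · exact ih r (h0.trans (by positivity)) h
  obtain ⟨r, hr⟩ := hA (-f)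
  obtain ⟨j, hj⟩ := exists_nat_ge (r * k ^ 2)
  refine iter j r ?_ (by simpa [add_comm] using hr)
  rw [← div_eq_mul_inv, le_div_iff₀ (pow_pos hk 2)]
  exact hj

end Algebra

end QuadraticModule

namespace VarRelax

open QuadraticModule MvPolynomial

theorem isQuadraticModule_weightedSOS {V : Type*} {r : ℕ} (p : Fin r → MvPolynomial V ℝ) :
    IsQuadraticModule (weightedSOS p) where
  one_mem := ⟨1, 0, IsSumSq.one, fun _ => .zero, by simp⟩
  add_mem := by
    rintro _ _ ⟨σ₀, σ, h₀, h, rfl⟩ ⟨τ₀, τ, h₀', h', rfl⟩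
    refine ⟨σ₀ + τ₀, σ + τ, h₀.add h₀', fun j => (h j).add (h' j), ?_⟩
    simp only [Pi.add_apply, add_mul, Finset.sum_add_distrib]
    ring
  sq_mul_mem := by
    rintro a _ ⟨σ₀, σ, h₀, h, rfl⟩
    refine ⟨a ^ 2 * σ₀, fun j => a ^ 2 * σ j, isSumSq_sq_mul a h₀,
      fun j => isSumSq_sq_mul a (h j), ?_⟩
    simp only [mul_add, Finset.mul_sum, mul_assoc]

theorem mem_weightedSOS_self {V : Type*} {r : ℕ} (p : Fin r → MvPolynomial V ℝ) (j : Fin r) :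
    p j ∈ weightedSOS p := by
  classical
  refine ⟨0, Pi.single j 1, .zero, fun i => ?_, ?_⟩
  · rcases eq_or_ne i j with rfl | h
    · rw [Pi.single_eq_same]; exact IsSumSq.one
    · rw [Pi.single_eq_of_ne h]; exact .zero
  · simp [Pi.single_apply]

/-- A quadratic module containing `R - ‖x‖²` is archimedean, because the bounded elements form a
subalgebra containing the variables. -/
theorem isArchimedean_of_normSqPoly {V : Type*} [Fintype V] {M : Set (MvPolynomial V ℝ)}
    (hM : IsQuadraticModule M) {R : ℝ} (hR : MvPolynomial.C R - normSqPoly V ∈ M) :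
    IsArchimedean M := by
  classical
  have hmono : ∀ {r s : ℝ} {a : MvPolynomial V ℝ}, r ≤ s → IsBoundedBy M r a → IsBoundedBy M s a := by
    intro r s a hrs ha
    have hs := hM.algebraMap_mem (sub_nonneg.2 hrs)
    constructor
    · convert! hM.add_mem ha.1 hs using 1
      rw [map_sub]; ring
    · convert! hM.add_mem ha.2 hs using 1
      rw [map_sub]; ring
  have hsum : ∀ s : Finset V, ∑ v ∈ s, (X v : MvPolynomial V ℝ) ^ 2 ∈ M := fun s =>
    Finset.sum_induction _ (· ∈ M) (fun _ _ => hM.add_mem) hM.zero_mem fun v _ => hM.sq_mem _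
  have hX : ∀ v : V, ∃ r : ℝ, 0 < r ∧ IsBoundedBy M r (X v) := by
    intro v
    have hv : MvPolynomial.C R - X v ^ 2 ∈ M := by
      convert! hM.add_mem hR (hsum (Finset.univ.erase v)) using 1
      rw [normSqPoly, ← Finset.add_sum_erase _ _ (Finset.mem_univ v)]
      ring
    have e : (MvPolynomial.C (1 / 2 : ℝ) : MvPolynomial V ℝ) * 2 = 1 := by
      rw [← map_ofNat (MvPolynomial.C (σ := V) (R := ℝ)) 2, ← map_mul]
      norm_num
    refine ⟨|R| + 1 / 4, by positivity, hmono (r := R + 1 / 4) (by linarith [le_abs_self R]) ⟨?_, ?_⟩⟩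
    · convert! hM.add_mem hv (hM.sq_mem (X v - MvPolynomial.C (1 / 2))) using 1
      rw [algebraMap_eq, show R + 1 / 4 = R + (1 / 2) ^ 2 by norm_num, map_add, map_pow]
      linear_combination X v * e
    · convert! hM.add_mem hv (hM.sq_mem (X v + MvPolynomial.C (1 / 2))) using 1
      rw [algebraMap_eq, show R + 1 / 4 = R + (1 / 2) ^ 2 by norm_num, map_add, map_pow]
      linear_combination -X v * e
  have hall : ∀ a : MvPolynomial V ℝ, ∃ r : ℝ, 0 < r ∧ IsBoundedBy M r a := by
    intro a
    induction a using MvPolynomial.induction_on with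
    | C c =>
      refine ⟨|c| + 1, by positivity, ?_, ?_⟩
      · rw [algebraMap_eq, ← map_sub]
        exact hM.algebraMap_mem (by linarith [le_abs_self c])
      · rw [algebraMap_eq, ← map_add]
        exact hM.algebraMap_mem (by linarith [neg_abs_le c])
    | add a b ha hb =>
      obtain ⟨r, hr, ha⟩ := ha
      obtain ⟨s, hs, hb⟩ := hb
      exact ⟨r + s, add_pos hr hs, ha.add hM hb⟩
    | mul_X a v ha =>
      obtain ⟨r, hr, ha⟩ := ha
      obtain ⟨s, hs, hv⟩ := hX v
      exact ⟨(r + s) ^ 2 / 4, by positivity, ha.mul hM hr hs hv⟩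
  exact fun a => (hall a).imp fun r hr => hr.2.1

/-- Putinar's Positivstellensatz. -/
theorem mem_weightedSOS_of_forall_pos {V : Type*} [Fintype V] {r : ℕ} {p : Fin r → MvPolynomial V ℝ}
    {R : ℝ} (hR : MvPolynomial.C R - normSqPoly V ∈ weightedSOS p) {f : MvPolynomial V ℝ}
    (hf : ∀ x : V → ℝ, (∀ j, 0 ≤ eval x (p j)) → 0 < eval x f) : f ∈ weightedSOS p := by
  have hQ := isQuadraticModule_weightedSOS p
  refine hQ.mem_of_forall_pos (isArchimedean_of_normSqPoly hQ hR) fun φ hφ => ?_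
  have e : ∀ a, φ a = eval (fun v => φ (X v)) a := fun a => by
    rw [← coe_aeval_eq_eval]
    exact DFunLike.congr_fun (aeval_unique φ) a
  rw [e]
  exact hf _ fun j => e (p j) ▸ hφ _ (mem_weightedSOS_self p j)

theorem eval_nonneg_of_mem_weightedSOS {V : Type*} {r : ℕ} {p : Fin r → MvPolynomial V ℝ}
    {f : MvPolynomial V ℝ} (hf : f ∈ weightedSOS p) {x : V → ℝ} (hx : ∀ j, 0 ≤ eval x (p j)) :
    0 ≤ eval x f := by
  have hsq : ∀ {s : MvPolynomial V ℝ}, IsSumSq s → 0 ≤ eval x s := fun hs => by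
    induction hs with
    | zero => simp
    | sq_add a _ ih => simpa using add_nonneg (mul_self_nonneg _) ih
  obtain ⟨σ₀, σ, h₀, h, rfl⟩ := hf
  simp only [map_add, map_sum, map_mul]
  exact add_nonneg (hsq h₀) (Finset.sum_nonneg fun j _ => mul_nonneg (hsq (h j)) (hx j))

end VarRelax

/-! ### Polynomial approximation, uniform and in `C¹` -/

namespace VarRelax

open MvPolynomial

theorem eval_aeval_continuousMap {V T : Type*} [TopologicalSpace T] (c : V → C(T, ℝ))
    (P : MvPolynomial V ℝ) (w : T) :
    (aeval c P : C(T, ℝ)) w = eval (fun v => c v w) P := by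
  induction P using MvPolynomial.induction_on with
  | C a => simp
  | add p q hp hq => simp [hp, hq]
  | mul_X p v hp => simp [hp]

/-- Weierstrass approximation on a compact set with injective coordinates. -/
theorem exists_eval_near_of_continuousOn {V T : Type*} [TopologicalSpace T] {K : Set T}
    (hK : IsCompact K) {coord : T → V → ℝ} (hc : Continuous coord)
    (hinj : Function.Injective coord) {φ : T → ℝ} (hφ : ContinuousOn φ K) {ε : ℝ} (hε : 0 < ε) :
    ∃ P : MvPolynomial V ℝ, ∀ w ∈ K, |eval (coord w) P - φ w| < ε := by
  have := isCompact_iff_compactSpace.1 hK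
  let c : V → C(K, ℝ) := fun v => ⟨fun w => coord w v, by fun_prop⟩
  have hsep : (aeval (R := ℝ) c).range.SeparatesPoints := by
    intro x y hxy
    obtain ⟨v, hv⟩ := Function.ne_iff.1 (hinj.ne (Subtype.coe_injective.ne hxy))
    exact ⟨c v, ⟨c v, ⟨X v, by simp⟩, rfl⟩, hv⟩
  obtain ⟨⟨p, hp⟩, hP⟩ :=
    ContinuousMap.exists_mem_subalgebra_near_continuous_of_separatesPoints _ hsep
      (K.domRestrict φ) hφ.domRestrict ε hε
  obtain ⟨P, rfl⟩ := AlgHom.mem_range _ |>.1 hp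
  refine ⟨P, fun w hw => ?_⟩
  have h : |(aeval c P : C(K, ℝ)) ⟨w, hw⟩ - φ w| < ε := hP ⟨w, hw⟩
  rwa [eval_aeval_continuousMap] at h

variable {V : Type*} [Fintype V]

/-- The convolution of a polynomial with a compactly supported function is a polynomial. -/
theorem exists_eval_eq_integral_sub_mul (Q : MvPolynomial V ℝ) {f : (V → ℝ) → ℝ}
    (hf : Continuous f) (hs : HasCompactSupport f) :
    ∃ P : MvPolynomial V ℝ, ∀ x, eval x P = ∫ y, eval (x - y) Q * f y := by
  induction Q using MvPolynomial.induction_on generalizing f with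
  | C a => exact ⟨C (a * ∫ y, f y), fun x => by simp [integral_const_mul]⟩
  | add p q hp hq =>
    obtain ⟨P, hP⟩ := hp hf hs
    obtain ⟨Q, hQ⟩ := hq hf hs
    refine ⟨P + Q, fun x => ?_⟩
    have hint : ∀ p : MvPolynomial V ℝ, Integrable (fun y => eval (x - y) p * f y) := fun p =>
      Continuous.integrable_of_hasCompactSupport
        (((continuous_eval p).comp (continuous_const.sub continuous_id)).mul hf) hs.mul_left
    rw [map_add, hP, hQ, ← integral_add (hint p) (hint q)]
    simp only [map_add, add_mul]
  | mul_X p v hp =>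
    obtain ⟨P, hP⟩ := hp hf hs
    obtain ⟨Q, hQ⟩ := hp (f := fun y => y v * f y) (by fun_prop) hs.mul_left
    refine ⟨X v * P - Q, fun x => ?_⟩
    have hint : ∀ g : (V → ℝ) → ℝ, Continuous g → HasCompactSupport g →
        Integrable (fun y => eval (x - y) p * g y) := fun g hg hgs =>
      Continuous.integrable_of_hasCompactSupport
        (((continuous_eval p).comp (continuous_const.sub continuous_id)).mul hg) hgs.mul_left
    rw [map_sub, map_mul, eval_X, hP, hQ, ← integral_const_mul,
      ← integral_sub ((hint f hf hs).const_mul _)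
        (hint (fun y => y v * f y) (by fun_prop) hs.mul_left)]
    congr 1 with y
    simp only [map_mul, eval_X, Pi.sub_apply]
    ring

/-- Convolutions with normalized Landau kernels `(N - ‖y‖²)ᵏ` converge uniformly on compact sets: on
the relevant box these kernels concentrate at their unique maximum `0`, and regarding the translates
of `G` as continuous functions on `K` makes the convergence uniform. -/
theorem exists_integral_smul_near {F : Type*} [NormedAddCommGroup F] [NormedSpace ℝ F]
    [CompleteSpace F] {G : (V → ℝ) → F} (hG : Continuous G) (hs : HasCompactSupport G)
    {K : Set (V → ℝ)} (hK : IsCompact K) {ε : ℝ} (hε : 0 < ε) :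
    ∃ Q : MvPolynomial V ℝ, ∀ x ∈ K, ‖(∫ y, eval y Q • G (x - y)) - G x‖ < ε := by
  have := isCompact_iff_compactSpace.1 hK
  obtain ⟨R₀, hR₀⟩ := (hs.isBounded.union hK.isBounded).subset_closedBall 0
  set R : ℝ := |R₀|
  have hRs : ∀ x ∈ tsupport G, ‖x‖ ≤ R := fun x hx =>
    (mem_closedBall_zero_iff.1 (hR₀ (Or.inl hx))).trans (le_abs_self _)
  have hRK : ∀ x ∈ K, ‖x‖ ≤ R := fun x hx =>
    (mem_closedBall_zero_iff.1 (hR₀ (Or.inr hx))).trans (le_abs_self _)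
  have hR : 0 ≤ R := abs_nonneg _
  set s : Set (V → ℝ) := Metric.closedBall 0 (2 * R + 1)
  have hsc : IsCompact s := isCompact_closedBall _ _
  -- With this `N` the kernel is nonnegative on the box `s`, which contains all differences between
  -- points of `K` and of the support of `G`.
  set N : ℝ := Fintype.card V * (2 * R + 1) ^ 2 + 1
  set Q : MvPolynomial V ℝ := C N - normSqPoly V
  have hQ : ∀ y, eval y Q = N - ∑ v, y v ^ 2 := fun y => by simp [Q, normSqPoly]
  have hQc : Continuous fun y => eval y Q := continuous_eval Q
  let g : C(V → ℝ, C(K, F)) := ContinuousMap.curry ⟨fun z => G (z.2 - z.1), by fun_prop⟩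
  have hlim : Tendsto (fun k : ℕ => (∫ y in s, eval y Q ^ k)⁻¹ • ∫ y in s, eval y Q ^ k • g y) atTop
      (𝓝 (g 0)) := by
    refine tendsto_setIntegral_pow_smul_of_unique_maximum_of_isCompact_of_continuousOn hsc
      hQc.continuousOn (fun y _ hy => ?_) (fun y hy => ?_) ?_ ?_ g.continuous.continuousOn
    · obtain ⟨v, hv⟩ := Function.ne_iff.1 hy
      have : 0 < ∑ v, y v ^ 2 := Finset.sum_pos' (fun _ _ => sq_nonneg _)
        ⟨v, Finset.mem_univ v, sq_pos_of_ne_zero hv⟩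
      simp only [hQ, Pi.zero_apply]
      simpa using this
    · have : ∑ v, y v ^ 2 ≤ ∑ _v : V, (2 * R + 1) ^ 2 := Finset.sum_le_sum fun v _ => by
        rw [sq_le_sq, abs_of_nonneg (by positivity : 0 ≤ 2 * R + 1)]
        exact (norm_le_pi_norm y v).trans (mem_closedBall_zero_iff.1 hy)
      rw [hQ]
      simp only [Finset.sum_const, Finset.card_univ, nsmul_eq_mul] at this
      simp only [N]
      linarith
    · rw [hQ]
      simp only [Pi.zero_apply, N, ne_eq, OfNat.ofNat_ne_zero, not_false_eq_true, zero_pow,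
        Finset.sum_const_zero, sub_zero]
      positivity
    · exact subset_closure (mem_interior_iff_mem_nhds.2 (Metric.closedBall_mem_nhds _ (by positivity)))
  obtain ⟨k, hk⟩ := (hlim.eventually (Metric.ball_mem_nhds (g 0) hε)).exists
  set a : ℝ := (∫ y in s, eval y Q ^ k)⁻¹
  have hint : IntegrableOn (fun y => eval y Q ^ k • g y) s :=
    ((hQc.pow k).smul g.continuous).continuousOn.integrableOn_compact hsc
  have hval : ∀ x (hx : x ∈ K), (∫ y in s, eval y Q ^ k • g y) ⟨x, hx⟩ =
      ∫ y, eval y Q ^ k • G (x - y) := by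
    intro x hx
    have e := (ContinuousMap.evalCLM ℝ (⟨x, hx⟩ : K)).integral_comp_comm hint
    simp only [ContinuousMap.evalCLM_apply] at e
    rw [← e]
    refine setIntegral_eq_integral_of_forall_compl_eq_zero fun y hy => ?_
    have hout : x - y ∉ tsupport G := fun h => hy <| by
      rw [mem_closedBall_zero_iff]
      have h1 := norm_sub_le x (x - y)
      rw [sub_sub_cancel] at h1
      linarith [hRK x hx, hRs _ h]
    simp [g, image_eq_zero_of_notMem_tsupport hout]
  refine ⟨C a * Q ^ k, fun x hx => ?_⟩
  have hx' : dist ((a • ∫ y in s, eval y Q ^ k • g y) ⟨x, hx⟩) (g 0 ⟨x, hx⟩) < ε :=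
    (ContinuousMap.dist_apply_le_dist _).trans_lt hk
  have hg : g 0 ⟨x, hx⟩ = G x := by simp [g]
  rw [ContinuousMap.smul_apply, hval x hx, hg, dist_eq_norm, ← integral_smul] at hx'
  simpa only [map_mul, map_pow, eval_C, mul_smul] using hx'

/-- A compactly supported `C¹` function is approximated in `C¹`, uniformly on compact sets, by its
convolutions with polynomials, which are polynomials. -/
theorem exists_eval_near_contDiff_of_hasCompactSupport {f : (V → ℝ) → ℝ} (hf : ContDiff ℝ 1 f)
    (hs : HasCompactSupport f) {K : Set (V → ℝ)} (hK : IsCompact K) {ε : ℝ} (hε : 0 < ε) :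
    ∃ P : MvPolynomial V ℝ, ∀ x ∈ K, |eval x P - f x| < ε ∧
      ‖fderiv ℝ (fun u => eval u P) x - fderiv ℝ f x‖ < ε := by
  have hfc : Continuous f := hf.continuous
  have hfd : Continuous (fderiv ℝ f) := hf.continuous_fderiv one_ne_zero
  obtain ⟨G, hG₁, hG₂⟩ : ∃ G : (V → ℝ) → ℝ × ((V → ℝ) →L[ℝ] ℝ),
      (∀ x, (G x).1 = f x) ∧ ∀ x, (G x).2 = fderiv ℝ f x :=
    ⟨fun x => (f x, fderiv ℝ f x), fun _ => rfl, fun _ => rfl⟩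
  have hGc : Continuous G := by
    have h : Continuous fun x => ((G x).1, (G x).2) := by
      simp only [hG₁, hG₂]
      exact hfc.prodMk hfd
    exact h
  have hsG : HasCompactSupport G := HasCompactSupport.intro hs.isCompact fun x hx => by
    refine Prod.ext ?_ ?_
    · rw [hG₁, image_eq_zero_of_notMem_tsupport hx, Prod.fst_zero]
    · rw [hG₂, image_eq_zero_of_notMem_tsupport fun h => hx (tsupport_fderiv_subset ℝ h),
        Prod.snd_zero]
  obtain ⟨Q, hQ⟩ := exists_integral_smul_near hGc hsG hK hε
  have hQc : Continuous fun y => eval y Q := continuous_eval Q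
  obtain ⟨P, hP⟩ := exists_eval_eq_integral_sub_mul Q hfc hs
  have hP' : ∀ x, eval x P = ∫ y, eval y Q * f (x - y) := fun x => by
    rw [hP, ← integral_sub_left_eq_self _ _ x]
    simp
  have hPd : ∀ x, fderiv ℝ (fun u => eval u P) x = ∫ y, eval y Q • fderiv ℝ f (x - y) := by
    intro x
    have := hs.hasFDerivAt_convolution_right (ContinuousLinearMap.mul ℝ ℝ)
      (μ := volume) (f := fun y => eval y Q) hQc.locallyIntegrable hf x
    refine HasFDerivAt.fderiv ?_
    convert! this using 1
    funext u
    rw [hP']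
    rfl
  refine ⟨P, fun x hx => ?_⟩
  have hint : Integrable fun y => eval y Q • G (x - y) :=
    Continuous.integrable_of_hasCompactSupport
      (hQc.smul (hGc.comp (continuous_const.sub continuous_id)))
      (HasCompactSupport.smul_left (f := fun y => eval y Q)
        (hsG.comp_homeomorph (Homeomorph.subLeft x)))
  have hx' := hQ x hx
  rw [Prod.norm_def, max_lt_iff, Prod.fst_sub, Prod.snd_sub, fst_integral hint,
    snd_integral hint, Real.norm_eq_abs] at hx'
  simp only [Prod.smul_fst, Prod.smul_snd, hG₁, hG₂, smul_eq_mul] at hx'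
  rw [hP', hPd]
  exact hx'

/-- Polynomial approximation in `C¹` on a compact set. -/
theorem exists_eval_near_contDiffOn {U K : Set (V → ℝ)} (hU : IsOpen U) (hK : IsCompact K)
    (hKU : K ⊆ U) {f : (V → ℝ) → ℝ} (hf : ContDiffOn ℝ 1 f U) {ε : ℝ} (hε : 0 < ε) :
    ∃ P : MvPolynomial V ℝ, ∀ x ∈ K, |eval x P - f x| < ε ∧
      ‖fderiv ℝ (fun u => eval u P) x - fderiv ℝ f x‖ < ε := by
  obtain ⟨L, hL, hKL, hLU⟩ := exists_compact_between hK hU hKU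
  obtain ⟨χ, h1, h0, -⟩ := exists_contMDiffMap_one_nhds_of_subset_interior (n := 1)
    (modelWithCornersSelf ℝ (V → ℝ)) hK.isClosed hKL
  have hχ : ContDiff ℝ 1 χ := χ.contMDiff.contDiff
  have hsupp : tsupport χ ⊆ L :=
    closure_minimal (fun x hx => by_contra fun h => hx (h0 x h)) hL.isClosed
  have hcomp : HasCompactSupport χ := HasCompactSupport.of_support_subset_isCompact hL
    ((subset_tsupport _).trans hsupp)
  have hsmooth : ContDiff ℝ 1 fun x => χ x * f x := by
    rw [contDiff_iff_contDiffAt]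
    intro x
    by_cases hx : x ∈ U
    · exact hχ.contDiffAt.mul (hf.contDiffAt (hU.mem_nhds hx))
    · have : (fun x => χ x * f x) =ᶠ[𝓝 x] fun _ => 0 := by
        filter_upwards [(isClosed_tsupport χ).isOpen_compl.mem_nhds
          (fun h => hx (hLU (hsupp h)))] with y hy
        rw [image_eq_zero_of_notMem_tsupport hy, zero_mul]
      exact contDiffAt_const.congr_of_eventuallyEq this
  obtain ⟨P, hP⟩ := exists_eval_near_contDiff_of_hasCompactSupport hsmooth hcomp.mul_right hK hε
  refine ⟨P, fun x hx => ?_⟩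
  have heq : (fun x => χ x * f x) =ᶠ[𝓝 x] f := by
    filter_upwards [h1.filter_mono (nhds_le_nhdsSet hx)] with y hy
    rw [hy, one_mul]
  have := hP x hx
  rwa [heq.fderiv_eq, heq.eq_of_nhds] at this

end VarRelax

/-! ### Coordinates and derivatives -/

namespace VarRelax

open MvPolynomial

theorem differentiableAt_eval_and_fderiv {V : Type*} [Fintype V] [DecidableEq V] (P : MvPolynomial V ℝ)
    (u : V → ℝ) : DifferentiableAt ℝ (fun u => eval u P) u ∧
      ∀ v, fderiv ℝ (fun u => eval u P) u (Pi.single v 1) = eval u (pderiv v P) := by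
  induction P using MvPolynomial.induction_on with
  | C a => simp
  | add p q hp hq =>
    simp only [map_add]
    refine ⟨hp.1.add hq.1, fun v => ?_⟩
    rw [fderiv_fun_add hp.1 hq.1, add_apply, hp.2, hq.2]
  | mul_X p j hp =>
    have hj : HasFDerivAt (fun u : V → ℝ => u j) (ContinuousLinearMap.proj j) u :=
      (ContinuousLinearMap.proj (R := ℝ) (φ := fun _ : V => ℝ) j).hasFDerivAt
    simp only [map_mul, eval_X]
    refine ⟨hp.1.mul hj.differentiableAt, fun v => ?_⟩
    rw [fderiv_fun_mul hp.1 hj.differentiableAt, hj.fderiv]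
    simp only [add_apply, smul_apply, hp.2,
      ContinuousLinearMap.proj_apply, Derivation.leibniz, pderiv_X, smul_eq_mul, map_add, map_mul,
      eval_X, Pi.single_apply]
    rcases eq_or_ne j v with rfl | h
    · simp
    · simp [h]

variable {n m : ℕ}

/-- The coordinates identify `ℝⁿ × ℝᵐ` with the functions on the set of variables. -/
noncomputable def coordEquiv (n m : ℕ) : (E n × E m) ≃L[ℝ] (VarXY n m → ℝ) :=
  ContinuousLinearEquiv.equivOfInverse
    (ContinuousLinearMap.pi (Sum.elim
      (fun k => EuclideanSpace.proj k ∘L ContinuousLinearMap.fst ℝ (E n) (E m))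
      (fun j => EuclideanSpace.proj j ∘L ContinuousLinearMap.snd ℝ (E n) (E m))))
    (ContinuousLinearMap.prod
      ((EuclideanSpace.equiv (Fin n) ℝ).symm.toContinuousLinearMap ∘L
        ContinuousLinearMap.pi fun k => ContinuousLinearMap.proj (Sum.inl k))
      ((EuclideanSpace.equiv (Fin m) ℝ).symm.toContinuousLinearMap ∘L
        ContinuousLinearMap.pi fun j => ContinuousLinearMap.proj (Sum.inr j)))
    (fun w => by ext <;> simp) (fun u => by ext (v | v) <;> simp)

theorem coordEquiv_apply (w : E n × E m) : coordEquiv n m w = coordXY w := by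
  ext (v | v) <;> simp [coordEquiv, coordXY]

theorem coordEquiv_single_inl (k : Fin n) :
    coordEquiv n m (EuclideanSpace.single k 1, 0) = Pi.single (Sum.inl k) 1 := by
  ext (v | v) <;> simp [coordEquiv_apply, coordXY, Pi.single_apply]

theorem coordEquiv_single_inr (j : Fin m) :
    coordEquiv n m (0, EuclideanSpace.single j 1) = Pi.single (Sum.inr j) 1 := by
  ext (v | v) <;> simp [coordEquiv_apply, coordXY, Pi.single_apply]

/-- The derivative of a component of `θ`, computed in coordinates. -/
theorem fderiv_component {θ : E n × E m → E n} {w : E n × E m} (hθ : DifferentiableAt ℝ θ w)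
    (v : E n × E m) (k : Fin n) :
    (fderiv ℝ θ w v) k =
      fderiv ℝ (fun u => θ ((coordEquiv n m).symm u) k) (coordXY w) (coordEquiv n m v) := by
  have h₁ : HasFDerivAt θ (fderiv ℝ θ w) ((coordEquiv n m).symm (coordXY w)) := by
    rw [← coordEquiv_apply, ContinuousLinearEquiv.symm_apply_apply]
    exact hθ.hasFDerivAt
  have h₂ := (EuclideanSpace.proj k : E n →L[ℝ] ℝ).hasFDerivAt.comp _
    (h₁.comp (coordXY w) (coordEquiv n m).symm.hasFDerivAt)
  have h₃ : fderiv ℝ (fun u => θ ((coordEquiv n m).symm u) k) (coordXY w) = _ := h₂.fderiv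
  rw [h₃]
  simp

theorem continuous_coordXY : Continuous (coordXY (n := n) (m := m)) :=
  (coordEquiv n m).continuous.congr coordEquiv_apply

theorem coordXY_injective : Function.Injective (coordXY (n := n) (m := m)) := fun w w' h =>
  (coordEquiv n m).injective <| by rw [coordEquiv_apply, coordEquiv_apply, h]

theorem coordXY_surjective : Function.Surjective (coordXY (n := n) (m := m)) := fun u => by
  obtain ⟨w, hw⟩ := (coordEquiv n m).surjective u
  exact ⟨w, by rw [← coordEquiv_apply, hw]⟩

theorem continuous_coordXYZ : Continuous (coordXYZ (n := n) (m := m)) := by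
  refine continuous_pi fun v => ?_
  rcases v with v | ⟨j, k⟩
  · have h : Continuous fun w : E n × E m × Mat m n => coordXY (w.1, w.2.1) :=
      continuous_coordXY.comp (by fun_prop)
    exact (continuous_apply v).comp h
  · have h : Continuous fun w : E n × E m × Mat m n => w.2.2 := by fun_prop
    exact h.matrix_elem j k

theorem coordXYZ_injective : Function.Injective (coordXYZ (n := n) (m := m)) := fun w w' h => by
  have h₁ : (w.1, w.2.1) = (w'.1, w'.2.1) := coordXY_injective <| funext fun v =>
    congrFun h (Sum.inl v)
  have h₂ : w.2.2 = w'.2.2 := by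
    ext j k
    exact congrFun h (Sum.inr (j, k))
  rw [Prod.mk.injEq] at h₁
  exact Prod.ext h₁.1 (Prod.ext h₁.2 h₂)

theorem coordXYZ_surjective : Function.Surjective (coordXYZ (n := n) (m := m)) := fun u => by
  obtain ⟨w, hw⟩ := coordXY_surjective fun v => u (Sum.inl v)
  refine ⟨(w.1, w.2, Matrix.of fun j k => u (Sum.inr (j, k))), funext ?_⟩
  rintro (v | ⟨j, k⟩)
  · exact congrFun hw v
  · rfl

theorem continuous_evalXY (P : PolyXY n m) : Continuous (evalXY P) :=
  (continuous_eval P).comp continuous_coordXY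

theorem continuous_evalXYZ (P : PolyXYZ n m) : Continuous (evalXYZ P) :=
  (continuous_eval P).comp continuous_coordXYZ

theorem continuous_evalField (N : Fin n → PolyX n) : Continuous (evalField N) := by
  refine (PiLp.continuous_toLp 2 _).comp (continuous_pi fun k => ?_)
  exact (continuous_eval (N k)).comp (by fun_prop)

theorem contDiff_evalXY (P : PolyXY n m) : ContDiff ℝ 1 (evalXY P) := by
  have h : ContDiff ℝ 1 fun u => eval u P := by
    induction P using MvPolynomial.induction_on with
    | C a => simpa using contDiff_const
    | add p q hp hq => simpa using hp.add hq
    | mul_X p v hp => simpa using hp.mul (contDiff_apply ℝ ℝ v)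
  have e : evalXY P = (fun u => eval u P) ∘ coordEquiv n m := by
    funext w
    simp only [evalXY, Function.comp, coordEquiv_apply]
  exact e ▸ h.comp (coordEquiv n m).contDiff

/-! ### Polynomial multipliers as functions -/

/-- The vector field on `ℝⁿ × ℝᵐ` whose components are polynomials in `(x, y)`. -/
noncomputable def evalFieldXY (Θ : Fin n → PolyXY n m) (w : E n × E m) : E n :=
  WithLp.toLp 2 fun k => evalXY (Θ k) w

theorem contDiff_evalFieldXY (Θ : Fin n → PolyXY n m) : ContDiff ℝ 1 (evalFieldXY Θ) :=
  contDiff_euclidean.2 fun k => contDiff_evalXY (Θ k)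

theorem fderiv_evalFieldXY (Θ : Fin n → PolyXY n m) (w v : E n × E m) (k : Fin n) :
    (fderiv ℝ (evalFieldXY Θ) w v) k =
      fderiv ℝ (fun u => eval u (Θ k)) (coordXY w) (coordEquiv n m v) := by
  rw [fderiv_component ((contDiff_evalFieldXY Θ).differentiable one_ne_zero w)]
  congr 2
  funext u
  simp only [evalFieldXY, evalXY, ← coordEquiv_apply, ContinuousLinearEquiv.apply_symm_apply]

theorem evalXYZ_liftXY (P : PolyXY n m) (w : E n × E m × Mat m n) :
    evalXYZ (liftXY P) w = evalXY P (w.1, w.2.1) := by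
  simp only [evalXYZ, liftXY, evalXY, eval_rename]
  rfl

theorem evalXY_liftX (P : PolyX n) (w : E n × E m) :
    evalXY (liftX m P) w = eval (fun j => w.1 j) P := by
  simp only [evalXY, liftX, eval_rename]
  rfl

theorem evalXYZ_bulkFPoly (l f g : PolyXYZ n m) (a : ℝ) (φ : PolyXYZ n m) (Θ : Fin n → PolyXY n m)
    (w : E n × E m × Mat m n) :
    evalXYZ (bulkFPoly l f g a φ Θ) w = evalXYZ l w + a * evalXYZ f w + evalXYZ φ w * evalXYZ g w +
      ∑ k, evalXY (pderiv (Sum.inl k) (Θ k)) (w.1, w.2.1) +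
      ∑ j, ∑ k, w.2.2 j k * evalXY (pderiv (Sum.inr j) (Θ k)) (w.1, w.2.1) := by
  have h : ∀ P : PolyXY n m, eval (coordXYZ w) (liftXY P) = evalXY P (w.1, w.2.1) :=
    fun P => evalXYZ_liftXY P w
  simp only [evalXYZ, bulkFPoly, map_add, map_mul, eval_C, h, Matrix.trace, Matrix.diag,
    Matrix.mul_apply, map_sum, zPoly, jacYPoly, Matrix.of_apply, Matrix.map_apply, eval_X,
    divXPoly]
  simp only [evalXY, map_sum]
  rfl

theorem bulkF_eq (l f g : E n × E m × Mat m n → ℝ) (a : ℝ) (φ : E n × E m × Mat m n → ℝ)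
    (θ : E n × E m → E n) (w : E n × E m × Mat m n) :
    bulkF l f g a φ θ w = l w + a * f w + φ w * g w +
      ∑ k, (fderiv ℝ θ (w.1, w.2.1) (EuclideanSpace.single k 1, 0)) k +
      ∑ j, ∑ k, w.2.2 j k * (fderiv ℝ θ (w.1, w.2.1) (0, EuclideanSpace.single j 1)) k := by
  simp [bulkF, divX, jacY, Matrix.trace, Matrix.mul_apply]

theorem bulkF_evalFieldXY (l f g : PolyXYZ n m) (a : ℝ) (φ : PolyXYZ n m)
    (Θ : Fin n → PolyXY n m) (w : E n × E m × Mat m n) :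
    bulkF (evalXYZ l) (evalXYZ f) (evalXYZ g) a (evalXYZ φ) (evalFieldXY Θ) w =
      evalXYZ (bulkFPoly l f g a φ Θ) w := by
  rw [bulkF_eq, evalXYZ_bulkFPoly]
  simp only [fderiv_evalFieldXY, coordEquiv_single_inl, coordEquiv_single_inr,
    (differentiableAt_eval_and_fderiv _ _).2, evalXY]

theorem evalXY_boundaryGPoly (h : PolyXY n m) (N : Fin n → PolyX n) (ψ : PolyXY n m)
    (Θ : Fin n → PolyXY n m) (w : E n × E m) :
    evalXY (boundaryGPoly h N ψ Θ) w =
      evalXY ψ w * evalXY h w - ∑ k, evalXY (Θ k) w * evalField N w.1 k := by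
  have h' : ∀ P : PolyX n, eval (coordXY w) (liftX m P) = eval (fun j => w.1 j) P :=
    fun P => evalXY_liftX P w
  simp only [evalXY, boundaryGPoly, map_sub, map_mul, map_sum, h', evalField]

theorem boundaryG_eq (h : E n × E m → ℝ) (N : E n → E n) (ψ : E n × E m → ℝ)
    (θ : E n × E m → E n) (w : E n × E m) :
    boundaryG h N ψ θ w = ψ w * h w - ∑ k, θ w k * N w.1 k := by
  simp [boundaryG, PiLp.inner_apply, mul_comm]

theorem boundaryG_evalFieldXY (h : PolyXY n m) (N : Fin n → PolyX n) (ψ : PolyXY n m)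
    (Θ : Fin n → PolyXY n m) (w : E n × E m) :
    boundaryG (evalXY h) (evalField N) (evalXY ψ) (evalFieldXY Θ) w =
      evalXY (boundaryGPoly h N ψ Θ) w := by
  rw [boundaryG_eq, evalXY_boundaryGPoly]
  rfl

end VarRelax

/-! ### Approximation of multipliers by polynomials -/

namespace VarRelax

open MvPolynomial

variable {n m s : ℕ}

/-- `C¹` approximation of a vector field by one with polynomial components, in coordinates. -/
theorem exists_evalFieldXY_near {X : Set (E n)} {Y : Set (E m)} (hX : IsCompact (closure X))
    (hY : IsCompact (closure Y)) {θ : E n × E m → E n} (hθ : IsC1On X Y θ) {δ : ℝ} (hδ : 0 < δ) :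
    ∃ Θ : Fin n → PolyXY n m, ∀ w ∈ closure X ×ˢ closure Y, ∀ k,
      |evalXY (Θ k) w - θ w k| < δ ∧
      (∀ i, |evalXY (pderiv (Sum.inl i) (Θ k)) w -
        (fderiv ℝ θ w (EuclideanSpace.single i 1, 0)) k| < δ) ∧
      ∀ j, |evalXY (pderiv (Sum.inr j) (Θ k)) w -
        (fderiv ℝ θ w (0, EuclideanSpace.single j 1)) k| < δ := by
  obtain ⟨U, hU, hKU, hθU⟩ := hθ
  let T := coordEquiv n m
  have key : ∀ k, ∃ P : PolyXY n m, ∀ w ∈ closure X ×ˢ closure Y, |evalXY P w - θ w k| < δ ∧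
      ∀ v, |fderiv ℝ (fun u => eval u P) (coordXY w) (T v) - (fderiv ℝ θ w v) k| ≤ δ / 2 * ‖T v‖ := by
    intro k
    have hf : ContDiffOn ℝ 1 (fun u => θ (T.symm u) k) (T.symm ⁻¹' U) :=
      contDiffOn_euclidean.1 (hθU.comp T.symm.contDiff.contDiffOn fun _ h => h) k
    obtain ⟨P, hP⟩ := exists_eval_near_contDiffOn (hU.preimage T.symm.continuous)
      ((hX.prod hY).image T.continuous) (by
        rintro _ ⟨w, hw, rfl⟩
        simpa using hKU hw) hf (half_pos hδ)
    refine ⟨P, fun w hw => ?_⟩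
    obtain ⟨h₁, h₂⟩ := hP _ ⟨w, hw, rfl⟩
    constructor
    · rw [T.symm_apply_apply, coordEquiv_apply] at h₁
      exact h₁.trans (half_lt_self hδ)
    · intro v
      have hd : DifferentiableAt ℝ θ w :=
        (hθU.contDiffAt (hU.mem_nhds (hKU hw))).differentiableAt one_ne_zero
      rw [fderiv_component hd, ← sub_apply, ← Real.norm_eq_abs]
      rw [coordEquiv_apply] at h₂
      exact (ContinuousLinearMap.le_opNorm _ _).trans
        (mul_le_mul_of_nonneg_right h₂.le (norm_nonneg _))
  choose Θ hΘ using key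
  have hsingle : ∀ v, ‖(Pi.single v 1 : VarXY n m → ℝ)‖ = 1 := fun v => by
    rw [Pi.norm_single, norm_one]
  refine ⟨Θ, fun w hw k => ⟨(hΘ k w hw).1, fun i => ?_, fun j => ?_⟩⟩
  · have := (hΘ k w hw).2 (EuclideanSpace.single i 1, 0)
    rw [coordEquiv_single_inl, (differentiableAt_eval_and_fderiv _ _).2, hsingle] at this
    exact this.trans_lt (by linarith)
  · have := (hΘ k w hw).2 (0, EuclideanSpace.single j 1)
    rw [coordEquiv_single_inr, (differentiableAt_eval_and_fderiv _ _).2, hsingle] at this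
    exact this.trans_lt (by linarith)

theorem isCompact_Omega {X : Set (E n)} {Y : Set (E m)} {Z : Set (Mat m n)}
    (hX : IsCompact (closure X)) (hY : IsCompact (closure Y)) (hZ : IsCompact (closure Z)) :
    IsCompact (Omega X Y Z) :=
  hX.prod (hY.prod hZ)

theorem abs_mul_sub_mul_le {a b c δ B : ℝ} (h : |a - b| < δ) (hc : |c| ≤ B) :
    |a * c - b * c| ≤ δ * B := by
  rw [← sub_mul, abs_mul]
  exact mul_le_mul h.le hc (abs_nonneg _) ((abs_nonneg _).trans h.le)

theorem abs_bulkFPoly_sub_le (l f g : PolyXYZ n m) (a : ℝ) {φ : E n × E m × Mat m n → ℝ}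
    {θ : E n × E m → E n} {Φ : PolyXYZ n m} {Θ : Fin n → PolyXY n m} {δ B : ℝ}
    {w : E n × E m × Mat m n} (hΦ : |evalXYZ Φ w - φ w| < δ)
    (hx : ∀ k i, |evalXY (pderiv (Sum.inl i) (Θ k)) (w.1, w.2.1) -
      (fderiv ℝ θ (w.1, w.2.1) (EuclideanSpace.single i 1, 0)) k| < δ)
    (hy : ∀ k j, |evalXY (pderiv (Sum.inr j) (Θ k)) (w.1, w.2.1) -
      (fderiv ℝ θ (w.1, w.2.1) (0, EuclideanSpace.single j 1)) k| < δ)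
    (hg : |evalXYZ g w| ≤ B) (hz : ∀ j k, |w.2.2 j k| ≤ B) :
    |evalXYZ (bulkFPoly l f g a Φ Θ) w -
      bulkF (evalXYZ l) (evalXYZ f) (evalXYZ g) a φ θ w| ≤ δ * (B + n + m * n * B) := by
  rw [evalXYZ_bulkFPoly, bulkF_eq]
  have h₁ := abs_mul_sub_mul_le hΦ hg
  have h₂ : |∑ k, evalXY (pderiv (Sum.inl k) (Θ k)) (w.1, w.2.1) -
      ∑ k, (fderiv ℝ θ (w.1, w.2.1) (EuclideanSpace.single k 1, 0)) k| ≤ n * δ := by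
    rw [← Finset.sum_sub_distrib]
    refine (Finset.abs_sum_le_sum_abs _ _).trans ?_
    refine (Finset.sum_le_card_nsmul _ _ δ fun k _ => (hx k k).le).trans_eq ?_
    simp
  have h₃ : |∑ j, ∑ k, w.2.2 j k * evalXY (pderiv (Sum.inr j) (Θ k)) (w.1, w.2.1) -
      ∑ j, ∑ k, w.2.2 j k * (fderiv ℝ θ (w.1, w.2.1) (0, EuclideanSpace.single j 1)) k| ≤
        m * (n * (δ * B)) := by
    rw [← Finset.sum_sub_distrib]
    refine (Finset.abs_sum_le_sum_abs _ _).trans ?_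
    refine (Finset.sum_le_card_nsmul _ _ (n * (δ * B)) fun j _ => ?_).trans_eq (by simp)
    rw [← Finset.sum_sub_distrib]
    refine (Finset.abs_sum_le_sum_abs _ _).trans ?_
    refine (Finset.sum_le_card_nsmul _ _ (δ * B) fun k _ => ?_).trans_eq (by simp)
    rw [mul_comm (w.2.2 j k), mul_comm (w.2.2 j k)]
    exact abs_mul_sub_mul_le (hy k j) (hz j k)
  rw [abs_le] at h₁ h₂ h₃ ⊢
  constructor <;> linarith

theorem abs_boundaryGPoly_sub_le (h : PolyXY n m)
    (N : Fin n → PolyX n) {ψ : E n × E m → ℝ} {θ : E n × E m → E n} {Ψ : PolyXY n m}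
    {Θ : Fin n → PolyXY n m} {δ B : ℝ} {w : E n × E m} (hΨ : |evalXY Ψ w - ψ w| < δ)
    (hΘ : ∀ k, |evalXY (Θ k) w - θ w k| < δ) (hh : |evalXY h w| ≤ B)
    (hN : ∀ k, |evalField N w.1 k| ≤ B) :
    |evalXY (boundaryGPoly h N Ψ Θ) w - boundaryG (evalXY h) (evalField N) ψ θ w| ≤
      δ * (B + n * B) := by
  rw [evalXY_boundaryGPoly, boundaryG_eq]
  have h₁ := abs_mul_sub_mul_le hΨ hh
  have h₂ : |∑ k, evalXY (Θ k) w * evalField N w.1 k - ∑ k, θ w k * evalField N w.1 k| ≤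
      n * (δ * B) := by
    rw [← Finset.sum_sub_distrib]
    refine (Finset.abs_sum_le_sum_abs _ _).trans ?_
    exact (Finset.sum_le_card_nsmul _ _ (δ * B) fun k _ =>
      abs_mul_sub_mul_le (hΘ k) (hN k)).trans_eq (by simp)
  rw [abs_le] at h₁ h₂ ⊢
  constructor <;> linarith

theorem _root_.IsCompact.exists_forall_abs_le {ι T : Type*} [Finite ι] [TopologicalSpace T]
    {K : Set T} (hK : IsCompact K) {F : ι → T → ℝ} (hF : ∀ i, ContinuousOn (F i) K) :
    ∃ B, ∀ i, ∀ w ∈ K, |F i w| ≤ B := by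
  have h : ∀ i, ∃ B, ∀ w ∈ K, |F i w| ≤ B := fun i =>
    (hK.exists_bound_of_continuousOn (hF i)).imp fun B hB w hw => hB w hw
  choose b hb using h
  obtain ⟨B, hB⟩ := (Set.finite_range b).bddAbove
  exact ⟨B, fun i w hw => (hb i w hw).trans (hB ⟨i, rfl⟩)⟩

/-- Arbitrary multipliers can be replaced by polynomial ones at the price of an arbitrarily small
uniform change of `F` and of the `Gᵢ`. -/
theorem exists_polynomial_multipliers {X : Set (E n)} {S : Fin s → Set (E n)} {Y : Set (E m)}
    {Z : Set (Mat m n)} (hX : IsCompact (closure X)) (hY : IsCompact (closure Y))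
    (hZ : IsCompact (closure Z)) (hS : ∀ i, IsCompact (Gamma (S i) Y))
    (hSX : ∀ i, Gamma (S i) Y ⊆ closure X ×ˢ closure Y) (l f g : PolyXYZ n m)
    (h : Fin s → PolyXY n m) (N : Fin s → Fin n → PolyX n) (a : ℝ)
    {φ : E n × E m × Mat m n → ℝ} {ψ : Fin s → E n × E m → ℝ} {θ : E n × E m → E n}
    (hφ : ContinuousOn φ (Omega X Y Z)) (hψ : ∀ i, ContinuousOn (ψ i) (Gamma (S i) Y))
    (hθ : IsC1On X Y θ) {ε : ℝ} (hε : 0 < ε) :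
    ∃ (Φ : PolyXYZ n m) (Ψ : Fin s → PolyXY n m) (Θ : Fin n → PolyXY n m),
      (∀ w ∈ Omega X Y Z, |evalXYZ (bulkFPoly l f g a Φ Θ) w -
        bulkF (evalXYZ l) (evalXYZ f) (evalXYZ g) a φ θ w| < ε) ∧
      ∀ i, ∀ w ∈ Gamma (S i) Y, |evalXY (boundaryGPoly (h i) (N i) (Ψ i) Θ) w -
        boundaryG (evalXY (h i)) (evalField (N i)) (ψ i) θ w| < ε := by
  have hΩ := isCompact_Omega hX hY hZ
  obtain ⟨B₁, hB₁⟩ := hΩ.exists_bound_of_continuousOn (continuous_evalXYZ g).continuousOn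
  obtain ⟨B₂, hB₂⟩ := hΩ.exists_forall_abs_le (F := fun (jk : Fin m × Fin n) w => w.2.2 jk.1 jk.2)
    fun jk => Continuous.continuousOn <|
      (show Continuous fun w : E n × E m × Mat m n => w.2.2 by fun_prop).matrix_elem jk.1 jk.2
  obtain ⟨B₃, hB₃⟩ := (hX.prod hY).exists_forall_abs_le (F := fun i => evalXY (h i))
    fun i => (continuous_evalXY _).continuousOn
  obtain ⟨B₄, hB₄⟩ := (hX.prod hY).exists_forall_abs_le
    (F := fun (ik : Fin s × Fin n) w => evalField (N ik.1) w.1 ik.2)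
    fun ik => ((EuclideanSpace.proj ik.2 : E n →L[ℝ] ℝ).continuous.comp
      ((continuous_evalField (N ik.1)).comp continuous_fst)).continuousOn
  set B := |B₁| + |B₂| + |B₃| + |B₄|
  have hB1 : B₁ ≤ B := by
    linarith [le_abs_self B₁, abs_nonneg B₂, abs_nonneg B₃, abs_nonneg B₄]
  have hB2 : B₂ ≤ B := by
    linarith [abs_nonneg B₁, le_abs_self B₂, abs_nonneg B₃, abs_nonneg B₄]
  have hB3 : B₃ ≤ B := by
    linarith [abs_nonneg B₁, abs_nonneg B₂, le_abs_self B₃, abs_nonneg B₄]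
  have hB4 : B₄ ≤ B := by
    linarith [abs_nonneg B₁, abs_nonneg B₂, abs_nonneg B₃, le_abs_self B₄]
  have hB0 : 0 ≤ B := by positivity
  -- `M` exceeds both constants by which the approximation error of the multipliers is amplified.
  set M : ℝ := B + n + m * n * B + n * B + 1
  have hM : 0 < M := by positivity
  have hδ : 0 < ε / M := div_pos hε hM
  have hlt : ∀ c, c < M → ε / M * c < ε := fun c hc => by
    rw [div_mul_eq_mul_div, div_lt_iff₀ hM]
    exact mul_lt_mul_of_pos_left hc hε
  obtain ⟨Φ, hΦ⟩ := exists_eval_near_of_continuousOn hΩ continuous_coordXYZ coordXYZ_injective hφ hδ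
  choose Ψ hΨ using fun i =>
    exists_eval_near_of_continuousOn (hS i) continuous_coordXY coordXY_injective (hψ i) hδ
  obtain ⟨Θ, hΘ⟩ := exists_evalFieldXY_near hX hY hθ hδ
  refine ⟨Φ, Ψ, Θ, fun w hw => ?_, fun i w hw => ?_⟩
  · have hw' : (w.1, w.2.1) ∈ closure X ×ˢ closure Y := ⟨hw.1, hw.2.1⟩
    refine (abs_bulkFPoly_sub_le l f g a (hΦ w hw) (fun k => (hΘ _ hw' k).2.1)
      (fun k => (hΘ _ hw' k).2.2) ((hB₁ w hw).trans hB1)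
      fun j k => (hB₂ (j, k) w hw).trans hB2).trans_lt (hlt _ ?_)
    have : (0 : ℝ) ≤ n * B := by positivity
    linarith
  · have hw' := hSX i hw
    refine (abs_boundaryGPoly_sub_le (h i) (N i) (hΨ i w hw) (fun k => (hΘ w hw' k).1)
      ((hB₃ i w hw').trans hB3) fun k => (hB₄ (i, k) w hw').trans hB4).trans_lt (hlt _ ?_)
    have : (0 : ℝ) ≤ m * n * B := by positivity
    have : (0 : ℝ) ≤ n := by positivity
    linarith

theorem continuousOn_bulkF {X : Set (E n)} {Y : Set (E m)} {Z : Set (Mat m n)}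
    (l f g : PolyXYZ n m) (a : ℝ) {φ : E n × E m × Mat m n → ℝ} {θ : E n × E m → E n}
    (hφ : ContinuousOn φ (Omega X Y Z)) (hθ : IsC1On X Y θ) :
    ContinuousOn (bulkF (evalXYZ l) (evalXYZ f) (evalXYZ g) a φ θ) (Omega X Y Z) := by
  obtain ⟨U, hU, hKU, hθU⟩ := hθ
  have hd : ∀ v k, ContinuousOn (fun w : E n × E m × Mat m n => (fderiv ℝ θ (w.1, w.2.1) v) k)
      (Omega X Y Z) := by
    intro v k
    have h₁ : ContinuousOn (fun w : E n × E m × Mat m n => fderiv ℝ θ (w.1, w.2.1))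
        (Omega X Y Z) :=
      (hθU.continuousOn_fderiv_of_isOpen hU le_rfl).comp (by fun_prop)
        fun w hw => hKU ⟨hw.1, hw.2.1⟩
    exact (EuclideanSpace.proj k : E n →L[ℝ] ℝ).continuous.comp_continuousOn
      (h₁.clm_apply continuousOn_const)
  have hz : ∀ j k, Continuous fun w : E n × E m × Mat m n => w.2.2 j k := fun j k =>
    (show Continuous fun w : E n × E m × Mat m n => w.2.2 by fun_prop).matrix_elem j k
  simp only [funext (bulkF_eq (evalXYZ l) (evalXYZ f) (evalXYZ g) a φ θ)]
  refine ((((continuous_evalXYZ l).continuousOn.add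
    ((continuous_evalXYZ f).const_mul a).continuousOn).add
    (hφ.mul (continuous_evalXYZ g).continuousOn)).add ?_).add ?_
  · exact continuousOn_finsetSum _ fun k _ => hd _ k
  · exact continuousOn_finsetSum _ fun j _ => continuousOn_finsetSum _ fun k _ =>
      (hz j k).continuousOn.mul (hd _ k)

theorem continuousOn_boundaryG {X S : Set (E n)} {Y : Set (E m)}
    (hSX : Gamma S Y ⊆ closure X ×ˢ closure Y) (h : PolyXY n m) (N : Fin n → PolyX n)
    {ψ : E n × E m → ℝ} {θ : E n × E m → E n} (hψ : ContinuousOn ψ (Gamma S Y))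
    (hθ : IsC1On X Y θ) :
    ContinuousOn (boundaryG (evalXY h) (evalField N) ψ θ) (Gamma S Y) := by
  obtain ⟨U, -, hKU, hθU⟩ := hθ
  exact (hψ.mul (continuous_evalXY h).continuousOn).sub
    ((hθU.continuousOn.mono (hSX.trans hKU)).inner
      ((continuous_evalField N).comp continuous_fst).continuousOn)

/-! ### Convergence of the strengthened programs -/

theorem exists_coe_eq_iInf_of_isCompact {T : Type*} [TopologicalSpace T] {K : Set T}
    (hK : IsCompact K) (hne : K.Nonempty) {F : T → ℝ} (hF : ContinuousOn F K) :
    ∃ b : ℝ, (⨅ w ∈ K, (F w : EReal)) = b ∧ ∀ w ∈ K, b ≤ F w := by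
  obtain ⟨w₀, hw₀, hmin⟩ := hK.exists_isMinOn hne hF
  exact ⟨F w₀, le_antisymm (iInf₂_le w₀ hw₀) (le_iInf₂ fun w hw => EReal.coe_le_coe (hmin hw)),
    fun w hw => hmin hw⟩

theorem _root_.EReal.coe_finsetSum {ι : Type*} (s : Finset ι) (f : ι → ℝ) :
    ((∑ i ∈ s, f i : ℝ) : EReal) = ∑ i ∈ s, (f i : EReal) := by
  classical
  induction s using Finset.induction_on with
  | empty => simp
  | insert i s hi ih => rw [Finset.sum_insert hi, Finset.sum_insert hi, EReal.coe_add, ih]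

theorem sosValue_mono (X : Set (E n)) (S : Fin s → Set (E n)) (l f g : PolyXYZ n m)
    (h : Fin s → PolyXY n m) (ν : Fin s → Fin n → PolyX n) {r : ℕ} (p : Fin r → PolyXYZ n m)
    {t : Fin s → ℕ} (q : ∀ i, Fin (t i) → PolyXY n m) :
    Monotone (sosValue X S l f g h ν p q) := by
  intro d d' hd
  refine sSup_le_sSup ?_
  rintro v ⟨a, b, c, φ, ψ, θ, hφ, hψ, hθ, hF, hG, rfl⟩
  exact ⟨a, b, c, φ, ψ, θ, hφ.trans hd, fun i => (hψ i).trans hd, fun k => (hθ k).trans hd, hF, hG,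
    rfl⟩

/-- Weak duality: membership in `Q(Ω)` and `Q(Γᵢ)` certifies lower bounds of `F` and `Gᵢ`. -/
theorem sosValue_le_dualValue (X : Set (E n)) (S : Fin s → Set (E n)) (Y : Set (E m))
    (Z : Set (Mat m n)) (l f g : PolyXYZ n m)
    (h : Fin s → PolyXY n m) (ν : Fin s → Fin n → PolyX n) {r : ℕ} (p : Fin r → PolyXYZ n m)
    (hp : Omega X Y Z = {w | ∀ j, 0 ≤ evalXYZ (p j) w})
    {t : Fin s → ℕ} (q : ∀ i, Fin (t i) → PolyXY n m)
    (hq : ∀ i, Gamma (S i) Y = {w | ∀ j, 0 ≤ evalXY (q i j) w}) (d : ℕ) :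
    sosValue X S l f g h ν p q d ≤ dualValue X S Y Z (evalXYZ l) (evalXYZ f) (evalXYZ g)
      (fun i => evalXY (h i)) (fun i => evalField (ν i)) := by
  refine sSup_le ?_
  rintro v ⟨a, b, c, Φ, Ψ, Θ, -, -, -, hF, hG, rfl⟩
  refine le_sSup_of_le ⟨a, evalXYZ Φ, fun i => evalXY (Ψ i), evalFieldXY Θ,
    (continuous_evalXYZ Φ).continuousOn, fun i => (continuous_evalXY _).continuousOn,
    ⟨Set.univ, isOpen_univ, Set.subset_univ _, (contDiff_evalFieldXY Θ).contDiffOn⟩, rfl⟩ ?_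
  rw [EReal.coe_add, EReal.coe_mul, EReal.coe_finsetSum]
  refine add_le_add ?_ (Finset.sum_le_sum fun i _ => ?_)
  · refine mul_le_mul_of_nonneg_left (le_iInf₂ fun w hw => ?_)
      (EReal.coe_nonneg.2 ENNReal.toReal_nonneg)
    rw [EReal.coe_le_coe_iff, bulkF_evalFieldXY]
    rw [hp] at hw
    have := eval_nonneg_of_mem_weightedSOS hF hw
    rw [map_sub, eval_C] at this
    exact sub_nonneg.1 this
  · rw [EReal.coe_mul]
    refine mul_le_mul_of_nonneg_left (le_iInf₂ fun w hw => ?_)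
      (EReal.coe_nonneg.2 ENNReal.toReal_nonneg)
    rw [EReal.coe_le_coe_iff, boundaryG_evalFieldXY]
    rw [hq] at hw
    have := eval_nonneg_of_mem_weightedSOS (hG i) hw
    rw [map_sub, eval_C] at this
    exact sub_nonneg.1 this

/-- Strong duality in the limit: any admissible value of the multiplier program is attained up to a
small error by polynomial multipliers, whose lower bounds Putinar's theorem certifies. -/
theorem dualValue_le_iSup_sosValue {X : Set (E n)} {S : Fin s → Set (E n)} {Y : Set (E m)}
    {Z : Set (Mat m n)} (hXne : X.Nonempty) (hYne : Y.Nonempty) (hZne : Z.Nonempty)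
    (hX : IsCompact (closure X)) (hY : IsCompact (closure Y)) (hZ : IsCompact (closure Z))
    (hSX : ∀ i, S i ⊆ closure X) (l f g : PolyXYZ n m)
    (h : Fin s → PolyXY n m) (ν : Fin s → Fin n → PolyX n) {r : ℕ} (p : Fin r → PolyXYZ n m)
    (hp : Omega X Y Z = {w | ∀ j, 0 ≤ evalXYZ (p j) w})
    {t : Fin s → ℕ} (q : ∀ i, Fin (t i) → PolyXY n m)
    (hq : ∀ i, Gamma (S i) Y = {w | ∀ j, 0 ≤ evalXY (q i j) w}) {C₀ : ℝ} {C' : Fin s → ℝ}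
    (hΩQ : MvPolynomial.C C₀ - normSqPoly (VarXYZ n m) ∈ weightedSOS p)
    (hΓQ : ∀ i, MvPolynomial.C (C' i) - normSqPoly (VarXY n m) ∈ weightedSOS (q i)) :
    dualValue X S Y Z (evalXYZ l) (evalXYZ f) (evalXYZ g)
      (fun i => evalXY (h i)) (fun i => evalField (ν i)) ≤ ⨆ d, sosValue X S l f g h ν p q d := by
  refine sSup_le ?_
  rintro v ⟨a, φ, ψ, θ, hφ, hψ, hθ, rfl⟩
  have hΓX : ∀ i, Gamma (S i) Y ⊆ closure X ×ˢ closure Y := fun i =>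
    Set.prod_mono (hSX i) subset_rfl
  have hΓ : ∀ i, IsCompact (Gamma (S i) Y) := fun i => by
    refine (hX.prod hY).of_isClosed_subset ?_ (hΓX i)
    rw [hq, Set.ofPred_forall]
    exact isClosed_iInter fun j => isClosed_le continuous_const (continuous_evalXY _)
  obtain ⟨b, hb, hbF⟩ := exists_coe_eq_iInf_of_isCompact (isCompact_Omega hX hY hZ)
    (hXne.closure.prod (hYne.closure.prod hZne.closure)) (continuousOn_bulkF l f g a hφ hθ)
  -- For an empty piece the infimum is `⊤`, but its weight, the area of the piece, is `0`.
  have hc : ∀ i, ∃ c : ℝ, ((surfaceMeasure n (S i)).toReal : EReal) *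
      (⨅ w ∈ Gamma (S i) Y, (boundaryG (evalXY (h i)) (evalField (ν i)) (ψ i) θ w : EReal)) =
        ((surfaceMeasure n (S i)).toReal * c : ℝ) ∧
      ∀ w ∈ Gamma (S i) Y, c ≤ boundaryG (evalXY (h i)) (evalField (ν i)) (ψ i) θ w := by
    intro i
    rcases (S i).eq_empty_or_nonempty with hS | hS
    · exact ⟨0, by simp [hS], fun w hw => by simp [Gamma, hS] at hw⟩
    · obtain ⟨c, hc, hcG⟩ := exists_coe_eq_iInf_of_isCompact (hΓ i) (hS.prod hYne.closure)
        (continuousOn_boundaryG (hΓX i) (h i) (ν i) (hψ i) hθ)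
      exact ⟨c, by rw [hc, EReal.coe_mul], hcG⟩
  choose c hc hcG using hc
  have hv : (((volume X).toReal * b + ∑ i, (surfaceMeasure n (S i)).toReal * c i : ℝ) : EReal) =
      ((volume X).toReal : EReal) *
        (⨅ w ∈ Omega X Y Z, (bulkF (evalXYZ l) (evalXYZ f) (evalXYZ g) a φ θ w : EReal)) +
      ∑ i, ((surfaceMeasure n (S i)).toReal : EReal) *
        (⨅ w ∈ Gamma (S i) Y,
          (boundaryG (evalXY (h i)) (evalField (ν i)) (ψ i) θ w : EReal)) := by
    rw [EReal.coe_add, EReal.coe_mul, EReal.coe_finsetSum, hb]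
    simp only [hc]
  rw [← hv]
  have hlim : Tendsto (fun ε : ℝ => (((volume X).toReal * (b - ε) +
      ∑ i, (surfaceMeasure n (S i)).toReal * (c i - ε) : ℝ) : EReal)) (𝓝[>] 0)
      (𝓝 (((volume X).toReal * b + ∑ i, (surfaceMeasure n (S i)).toReal * c i : ℝ) : EReal)) := by
    have : Continuous fun ε : ℝ => (((volume X).toReal * (b - ε) +
        ∑ i, (surfaceMeasure n (S i)).toReal * (c i - ε) : ℝ) : EReal) :=
      continuous_coe_real_ereal.comp (by fun_prop)
    simpa using (this.tendsto 0).mono_left nhdsWithin_le_nhds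
  refine le_of_tendsto hlim (eventually_nhdsWithin_of_forall fun ε (hε : 0 < ε) => ?_)
  obtain ⟨Φ, Ψ, Θ, hFF, hGG⟩ := exists_polynomial_multipliers hX hY hZ hΓ hΓX l f g h ν a hφ hψ hθ hε
  refine le_iSup_of_le (Φ.totalDegree ⊔ Finset.univ.sup (fun i => (Ψ i).totalDegree) ⊔
    Finset.univ.sup fun k => (Θ k).totalDegree) (le_sSup ?_)
  refine ⟨a, b - ε, fun i => c i - ε, Φ, Ψ, Θ, le_sup_left.trans le_sup_left, fun i => ?_,
    fun k => ?_, ?_, fun i => ?_, rfl⟩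
  · exact (Finset.le_sup (f := fun i => (Ψ i).totalDegree) (Finset.mem_univ i)).trans
      (le_sup_right.trans le_sup_left)
  · exact (Finset.le_sup (f := fun k => (Θ k).totalDegree) (Finset.mem_univ k)).trans le_sup_right
  · refine mem_weightedSOS_of_forall_pos hΩQ fun x hx => ?_
    obtain ⟨w, rfl⟩ := coordXYZ_surjective x
    have hw : w ∈ Omega X Y Z := hp ▸ hx
    have h₁ := (abs_lt.1 (hFF w hw)).1
    have h₂ := hbF w hw
    rw [map_sub, eval_C]
    simp only [evalXYZ] at h₁ h₂
    linarith
  · refine mem_weightedSOS_of_forall_pos (hΓQ i) fun x hx => ?_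
    obtain ⟨w, rfl⟩ := coordXY_surjective x
    have hw : w ∈ Gamma (S i) Y := hq i ▸ hx
    have h₁ := (abs_lt.1 (hGG i w hw)).1
    have h₂ := hcG i w hw
    rw [map_sub, eval_C]
    simp only [evalXY] at h₁ h₂
    linarith

end VarRelax

theorem mainTheorem3 {n m s : ℕ}
    (X : Set (VarRelax.E n)) (S : Fin s → Set (VarRelax.E n))
    (hX : VarRelax.IsPiecewiseSmoothDomain X S)
    (Y : Set (VarRelax.E m)) (hY : Y.Nonempty)
    (Z : Set (VarRelax.Mat m n)) (hZ : Z.Nonempty)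
    (l f g : VarRelax.PolyXYZ n m) (h : Fin s → VarRelax.PolyXY n m)
    (ν : Fin s → Fin n → VarRelax.PolyX n)
    (hν : ∀ i, VarRelax.IsOutwardUnitNormal X (S i) (VarRelax.evalField (ν i)))
    {r : ℕ} (p : Fin r → VarRelax.PolyXYZ n m)
    (hp : VarRelax.Omega X Y Z = {w | ∀ j, 0 ≤ VarRelax.evalXYZ (p j) w})
    {t : Fin s → ℕ} (q : ∀ i, Fin (t i) → VarRelax.PolyXY n m)
    (hq : ∀ i, VarRelax.Gamma (S i) Y = {w | ∀ j, 0 ≤ VarRelax.evalXY (q i j) w})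
    (hXc : IsCompact (closure X)) (hYc : IsCompact (closure Y)) (hZc : IsCompact (closure Z))
    (C₀ : ℝ) (hC₀ : 0 < C₀) (C : Fin s → ℝ) (hC : ∀ i, 0 < C i)
    (hΩQ : MvPolynomial.C C₀ - VarRelax.normSqPoly (VarRelax.VarXYZ n m) ∈ VarRelax.weightedSOS p)
    (hΓQ : ∀ i, MvPolynomial.C (C i) - VarRelax.normSqPoly (VarRelax.VarXY n m) ∈
      VarRelax.weightedSOS (q i)) :
    Filter.Tendsto (fun d : ℕ => VarRelax.sosValue X S l f g h ν p q d) Filter.atTop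
      (nhds (VarRelax.dualValue X S Y Z (VarRelax.evalXYZ l) (VarRelax.evalXYZ f)
        (VarRelax.evalXYZ g) (fun i => VarRelax.evalXY (h i))
        (fun i => VarRelax.evalField (ν i)))) := by
  have hSX : ∀ i, S i ⊆ closure X := fun i =>
    ((Set.subset_iUnion S i).trans_eq hX.boundary_eq.symm).trans frontier_subset_closure
  have heq := le_antisymm
    (VarRelax.dualValue_le_iSup_sosValue hX.isConnected.nonempty hY hZ hXc hYc hZc hSX l f g h ν p hp
      q hq hΩQ hΓQ)
    (iSup_le fun d => VarRelax.sosValue_le_dualValue X S Y Z l f g h ν p hp q hq d)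
  rw [heq]
  exact tendsto_atTop_iSup (VarRelax.sosValue_mono X S l f g h ν p q)
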